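/- Let $0\le k\le n$, let $S\subseteq\mathbb{R}^n$ be a $k$-dimensional (embedded, not necessarily compact or connected) $C^1$ submanifold with tangent spaces $T_\xi S$ and surface measure $\sigma$, and let $\pi\subseteq\mathbb{R}^n$ be a $k$-dimensional linear subspace such that $$\text{(T)}\quad T_\xi S\cap\pi^\perp=\{0\}\ \text{ for all }\xi\in S,\qquad\qquad \text{(GT)}\quad \langle\xi-\eta\rangle\cap\pi^\perp=\{0\}\ \text{ for all }\xi,\eta\in S,$$ where $\langle v\rangle$ is the linear span of $v$. Let $g\in L^1(S,d\sigma)$ be complex-valued, let $\widehat{gd\sigma}(x)=\int_S g(\xi)e^{-2\pi i x\cdot\xi}\,d\sigma(\xi)$ for $x\in\mathbb{R}^n$, and put $$C=\int_S\frac{|g(\xi)|^2}{|(T_\xi S)^\perp\wedge\pi|}\,d\sigma(\xi)\in[0,\infty].$$ Here, for subspaces $V,W$ of $\mathbb{R}^n$ of complementary dimensions $\ell,m$, $|V\wedge W|=|v_1\wedge\cdots\wedge v_\ell\wedge w_1\wedge\cdots\wedge w_m|$ for any orthonormal bases $(v_i)$ of $V$ and $(w_j)$ of $W$. (i) For $f:\mathbb{R}^n\to[0,\infty]$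 let $T_{k,n}f(\pi,y)=\int_\pi f(x+y)\,d\lambda_\pi(x)$ be its $k$-plane transform, $\lambda_\pi$ being Lebesgue measure on $\pi$. Then for every $y\in\pi^\perp$, $$T_{k,n}\big(|\widehat{gd\sigma}|^2\big)(\pi,y)=C ,$$ as an identity in $[0,\infty]$; in particular the left-hand side does not depend on $y$. (ii) Let $\mathfrak{M}_{n-k,n}$ be the manifold of pairs $(\theta,z)$, with $\theta$ an $(n-k)$-dimensional subspace of $\mathbb{R}^n$ and $z\in\theta^\perp$, which parametrise the affine $(n-k)$-planes $\theta+z$. For a Borel measure $\mu$ on $\mathfrak{M}_{n-k,n}$ let $T^*_{n-k,n}\mu=\int_{\mathfrak{M}_{n-k,n}}\delta_{\theta+\{z\}}\,d\mu(\theta,z)$, a measure on $\mathbb{R}^n$, where $\delta_{\theta+\{z\}}$ is Lebesgue measure on the plane $\theta+z$. Let $TS=\{(\xi,y):\xi\in S,\ y\in T_\xi S\}$, let $\nu$ be any Borel measure on $TS$ whose pushforward under $(\xi,y)\mapsto\xi$ is $|g|^2d\sigma$, and let $\mu$ be the pushforward of $\nu$ under the Gauss map $TS\ni(\xi,y)\mapsto((T_\xi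 S)^\perp,y)\in\mathfrak{M}_{n-k,n}$. Then for every $y\in\pi^\perp$, $$T_{k,n}T^*_{n-k,n}\mu(\pi,y)=C .$$ Here, for a measure $m$ on $\mathbb{R}^n$, let $m_\pi$ be its image under the orthogonal projection onto $\pi^\perp$; when $m$ has a density $f\ge0$, $m_\pi$ has density $T_{k,n}f(\pi,\cdot)$ with respect to Lebesgue measure $\lambda_{\pi^\perp}$ on $\pi^\perp$. The identity is asserted in both of the following senses, with $m=T^*_{n-k,n}\mu$: pointwise, $T_{k,n}m(\pi,y):=\lim_{\varepsilon\to0^+}m_\pi(B(y,\varepsilon))/\lambda_{\pi^\perp}(B(y,\varepsilon))=C$ for every $y\in\pi^\perp$, where $B(y,\varepsilon)$ is the open ball in $\pi^\perp$; and as measures on $\pi^\perp$, $m_\pi=C\,\lambda_{\pi^\perp}$. -/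

import Mathlib

open MeasureTheory Set Filter Topology
open scoped ENNReal

noncomputable section

namespace KPlane

/-- `S` is a `k`-dimensional (embedded) `C¹` submanifold of `ℝⁿ`: around each of its points there is
a `C¹` diffeomorphism between open subsets of `ℝⁿ` that carries `S` to a `k`-dimensional linear
subspace. -/
def IsC1Submanifold {n : ℕ} (k : ℕ) (S : Set (EuclideanSpace ℝ (Fin n))) : Prop :=
  ∀ ξ ∈ S, ∃ (Φ : OpenPartialHomeomorph (EuclideanSpace ℝ (Fin n)) (EuclideanSpace ℝ (Fin n)))
    (V : Submodule ℝ (EuclideanSpace ℝ (Fin n))),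
    ξ ∈ Φ.source ∧ Module.finrank ℝ V = k ∧
    ContDiffOn ℝ 1 Φ Φ.source ∧ ContDiffOn ℝ 1 Φ.symm Φ.target ∧
    ∀ x ∈ Φ.source, (x ∈ S ↔ Φ x ∈ V)

/-- The tangent space `T_ξ S`: the span of the velocities at `ξ` of the curves in `S` through `ξ`
(for a `C¹` submanifold these velocities already form a subspace). -/
def tangentSpaceAt {n : ℕ} (S : Set (EuclideanSpace ℝ (Fin n))) (ξ : EuclideanSpace ℝ (Fin n)) :
    Submodule ℝ (EuclideanSpace ℝ (Fin n)) :=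
  Submodule.span ℝ {v | ∃ γ : ℝ → EuclideanSpace ℝ (Fin n),
    γ 0 = ξ ∧ HasDerivAt γ v 0 ∧ ∀ᶠ t in 𝓝 (0 : ℝ), γ t ∈ S}

/-- The tangent spaces of a `k`-dimensional `C¹` submanifold are `k`-dimensional; this is needed for
the Gauss map to take values in the `(n-k)`-planes. -/
theorem IsC1Submanifold.finrank_tangentSpaceAt {n k : ℕ} {S : Set (EuclideanSpace ℝ (Fin n))}
    (hS : IsC1Submanifold k S) {ξ : EuclideanSpace ℝ (Fin n)} (hξ : ξ ∈ S) :
    Module.finrank ℝ (tangentSpaceAt S ξ) = k := by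
  obtain ⟨Φ, V, hsrc, hV, hΦ, hΨ, hSV⟩ := hS ξ hξ
  have htgt : Φ ξ ∈ Φ.target := Φ.map_source hsrc
  have dΦ : HasFDerivAt Φ (fderiv ℝ Φ ξ) ξ :=
    ((hΦ.contDiffAt (Φ.open_source.mem_nhds hsrc)).differentiableAt one_ne_zero).hasFDerivAt
  have dΨ : HasFDerivAt Φ.symm (fderiv ℝ Φ.symm (Φ ξ)) (Φ ξ) :=
    ((hΨ.contDiffAt (Φ.open_target.mem_nhds htgt)).differentiableAt one_ne_zero).hasFDerivAt
  set A := fderiv ℝ Φ ξ with hA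
  set D := fderiv ℝ Φ.symm (Φ ξ) with hD
  have hDA : ∀ v, D (A v) = v := by
    have h1 : HasFDerivAt (Φ.symm ∘ Φ) (D.comp A) ξ := dΨ.comp ξ dΦ
    have h2 : HasFDerivAt (Φ.symm ∘ Φ) (ContinuousLinearMap.id ℝ _) ξ :=
      (hasFDerivAt_id ξ).congr_of_eventuallyEq (Φ.eventually_left_inverse hsrc)
    intro v
    exact congrArg (fun L => L v) (h1.unique h2)
  have hAD : ∀ v, A (D v) = v := by
    have dΦ' : HasFDerivAt Φ A (Φ.symm (Φ ξ)) := by rwa [Φ.left_inv hsrc]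
    have h1 : HasFDerivAt (Φ ∘ Φ.symm) (A.comp D) (Φ ξ) := dΦ'.comp (Φ ξ) dΨ
    have h2 : HasFDerivAt (Φ ∘ Φ.symm) (ContinuousLinearMap.id ℝ _) (Φ ξ) :=
      (hasFDerivAt_id (Φ ξ)).congr_of_eventuallyEq (Φ.eventually_right_inverse htgt)
    intro v
    exact congrArg (fun L => L v) (h1.unique h2)
  have hT : tangentSpaceAt S ξ = V.map (D : _ →ₗ[ℝ] _) := by
    apply le_antisymm
    · refine Submodule.span_le.2 ?_
      rintro v ⟨γ, h0, hγ, hγS⟩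
      refine ⟨A v, ?_, hDA v⟩
      have dΦ' : HasFDerivAt Φ A (γ 0) := by rwa [h0]
      have h1 : HasDerivAt (Φ ∘ γ) (A v) 0 := dΦ'.comp_hasDerivAt (0 : ℝ) hγ
      have h2 : HasDerivAt (fun t => Vᗮ.starProjection ((Φ ∘ γ) t)) (Vᗮ.starProjection (A v)) 0 :=
        (Vᗮ.starProjection.hasFDerivAt).comp_hasDerivAt (0 : ℝ) h1
      have hev : (fun t => Vᗮ.starProjection ((Φ ∘ γ) t)) =ᶠ[𝓝 0] fun _ => 0 := by
        have hs : ∀ᶠ t in 𝓝 (0 : ℝ), γ t ∈ Φ.source :=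
          hγ.continuousAt.eventually_mem (by rw [h0]; exact Φ.open_source.mem_nhds hsrc)
        filter_upwards [hγS, hs] with t ht hts
        rw [Submodule.starProjection_apply_eq_zero_iff, Submodule.orthogonal_orthogonal]
        exact (hSV _ hts).1 ht
      have h3 := h2.unique ((hasDerivAt_const (0 : ℝ) _).congr_of_eventuallyEq hev)
      rw [Submodule.starProjection_apply_eq_zero_iff, Submodule.orthogonal_orthogonal] at h3
      exact h3
    · rintro _ ⟨w, hw, rfl⟩
      refine Submodule.subset_span ⟨fun t => Φ.symm (Φ ξ + t • w), ?_, ?_, ?_⟩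
      · simp [Φ.left_inv hsrc]
      · have hl : HasDerivAt (fun t : ℝ => Φ ξ + t • w) w 0 := by
          simpa using ((hasDerivAt_id (0 : ℝ)).smul_const w).const_add (Φ ξ)
        have dΨ' : HasFDerivAt Φ.symm D (Φ ξ + (0 : ℝ) • w) := by simpa using dΨ
        exact dΨ'.comp_hasDerivAt (0 : ℝ) hl
      · have hc : ContinuousAt (fun t : ℝ => Φ ξ + t • w) 0 := by fun_prop
        have hs : ∀ᶠ t in 𝓝 (0 : ℝ), Φ ξ + t • w ∈ Φ.target :=
          hc.eventually_mem (by simpa using Φ.open_target.mem_nhds htgt)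
        filter_upwards [hs] with t ht
        rw [hSV _ (Φ.map_target ht), Φ.right_inv ht]
        exact V.add_mem ((hSV _ hsrc).1 hξ) (V.smul_mem t hw)
  have hinj : Function.Injective (D : EuclideanSpace ℝ (Fin n) →ₗ[ℝ] EuclideanSpace ℝ (Fin n)) :=
    fun a b hab => by
      have := congrArg A hab
      simpa [hAD] using this
  rw [hT, ← (Submodule.equivMapOfInjective _ hinj V).finrank_eq, hV]

/-- Surface measure `dσ` on `S`: the `k`-dimensional Hausdorff measure, normalised so that it is
Lebesgue measure on `k`-dimensional Euclidean spaces. -/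
def surfaceMeasure {n : ℕ} (k : ℕ) (S : Set (EuclideanSpace ℝ (Fin n))) : Measure S :=
  Measure.euclideanHausdorffMeasure k

/-- The Fourier extension operator `x ↦ ∫_S g(ξ) exp(-2πi x·ξ) dσ(ξ)`. -/
def extensionOperator {n : ℕ} (k : ℕ) (S : Set (EuclideanSpace ℝ (Fin n))) (g : S → ℂ)
    (x : EuclideanSpace ℝ (Fin n)) : ℂ :=
  ∫ ξ : S, g ξ * Complex.exp
    (-(2 * (Real.pi : ℂ) * Complex.I * ((inner ℝ x (ξ : EuclideanSpace ℝ (Fin n)) : ℝ) : ℂ)))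
    ∂(surfaceMeasure k S)

/-- The `k`-plane transform `f ↦ ∫_π f(x + y) dλ_π(x)` of a nonnegative function, where
`k = dim π`. -/
def planeTransform {n : ℕ} (f : EuclideanSpace ℝ (Fin n) → ℝ≥0∞)
    (π : Submodule ℝ (EuclideanSpace ℝ (Fin n))) (y : EuclideanSpace ℝ (Fin n)) : ℝ≥0∞ :=
  ∫⁻ x : π, f ((x : EuclideanSpace ℝ (Fin n)) + y)

/-- `|V ∧ W| = |v₁ ∧ ⋯ ∧ v_ℓ ∧ w₁ ∧ ⋯ ∧ w_m|` for orthonormal bases `v` of `V` and `w` of `W`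
(the choice is immaterial); the norm of a wedge product of vectors is the square root of their
Gram determinant. -/
def wedgeNorm {n : ℕ} (V W : Submodule ℝ (EuclideanSpace ℝ (Fin n))) : ℝ :=
  Real.sqrt (Matrix.gram ℝ (Sum.elim
    (fun i => (stdOrthonormalBasis ℝ V i : EuclideanSpace ℝ (Fin n)))
    (fun j => (stdOrthonormalBasis ℝ W j : EuclideanSpace ℝ (Fin n))))).det

/-- The manifold of affine `d`-planes `θ + z` in `ℝⁿ`, with `θ` a `d`-dimensional subspace and
`z ∈ θ^⊥`. -/
@[ext]
structure AffinePlane (d n : ℕ) where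
  /-- the direction `θ` -/
  direction : Submodule ℝ (EuclideanSpace ℝ (Fin n))
  /-- the translation parameter `z` -/
  offset : EuclideanSpace ℝ (Fin n)
  finrank_direction : Module.finrank ℝ direction = d
  offset_mem : offset ∈ directionᗮ

/-- The usual topology: a subspace is identified with the orthogonal projection onto it. -/
instance (d n : ℕ) : TopologicalSpace (AffinePlane d n) :=
  TopologicalSpace.induced
    (fun p => ((p.direction.starProjection :
      EuclideanSpace ℝ (Fin n) →L[ℝ] EuclideanSpace ℝ (Fin n)), p.offset)) inferInstance

instance (d n : ℕ) : MeasurableSpace (AffinePlane d n) := borel _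

instance (d n : ℕ) : BorelSpace (AffinePlane d n) := ⟨rfl⟩

/-- `δ_{θ+z}`: Lebesgue measure on the affine plane `θ + z`, as a measure on `ℝⁿ`. -/
def AffinePlane.lebesgue {d n : ℕ} (p : AffinePlane d n) : Measure (EuclideanSpace ℝ (Fin n)) :=
  Measure.map (fun w : p.direction => (w : EuclideanSpace ℝ (Fin n)) + p.offset) volume

/-- The adjoint `d`-plane transform `∫ δ_{θ+z} dμ(θ, z)` of a measure `μ` on the affine `d`-planes,
as a measure on `ℝⁿ`. -/
def adjointPlaneTransform {d n : ℕ} (μ : Measure (AffinePlane d n)) :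
    Measure (EuclideanSpace ℝ (Fin n)) :=
  μ.bind AffinePlane.lebesgue

/-- The `k`-plane transform of a measure `m` on `ℝⁿ` in the direction `π` (with `k = dim π`), as a
measure in the translation parameter: the image of `m` under the orthogonal projection onto `π^⊥`.
If `m` has the density `f`, this measure has the density `y ↦ ∫_π f(x + y) dλ_π(x)`. -/
def planeTransformMeasure {n : ℕ} (m : Measure (EuclideanSpace ℝ (Fin n)))
    (π : Submodule ℝ (EuclideanSpace ℝ (Fin n))) : Measure πᗮ :=
  m.map (fun x => πᗮ.orthogonalProjectionOnto x)

/-- The `k`-plane transform of the measure `m` on `ℝⁿ` has the value `c` at `(π, y)`: the pairing of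
`m` with `δ_{π+y}`, understood as the limit of the normalised indicators of the `ε`-neighbourhoods
of `π + y`, converges to `c`. -/
def HasPlaneTransformAt {n : ℕ} (m : Measure (EuclideanSpace ℝ (Fin n)))
    (π : Submodule ℝ (EuclideanSpace ℝ (Fin n))) (y : πᗮ) (c : ℝ≥0∞) : Prop :=
  Tendsto (fun ε : ℝ =>
    planeTransformMeasure m π (Metric.ball y ε) / volume (Metric.ball y ε)) (𝓝[>] 0) (𝓝 c)

/-- The tangent bundle `TS = {(ξ, y) : ξ ∈ S, y ∈ T_ξ S}`. -/
def tangentBundle {n : ℕ} (S : Set (EuclideanSpace ℝ (Fin n))) :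
    Set (EuclideanSpace ℝ (Fin n) × EuclideanSpace ℝ (Fin n)) :=
  {p | p.1 ∈ S ∧ p.2 ∈ tangentSpaceAt S p.1}

/-- The projection `(ξ, y) ↦ ξ` of the tangent bundle. -/
def tangentBundle.proj {n : ℕ} {S : Set (EuclideanSpace ℝ (Fin n))} (p : tangentBundle S) : S :=
  ⟨p.1.1, p.2.1⟩

/-- The Gauss map `(ξ, y) ↦ ((T_ξ S)^⊥, y)`. -/
def gaussMap {n k : ℕ} {S : Set (EuclideanSpace ℝ (Fin n))} (hS : IsC1Submanifold k S)
    (p : tangentBundle S) : AffinePlane (n - k) n where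
  direction := (tangentSpaceAt S p.1.1)ᗮ
  offset := p.1.2
  finrank_direction := by
    have h := (tangentSpaceAt S p.1.1).finrank_add_finrank_orthogonal
    rw [hS.finrank_tangentSpaceAt p.2.1, finrank_euclideanSpace_fin] at h
    omega
  offset_mem := Submodule.le_orthogonal_orthogonal _ p.2.2

end KPlane

end

/-!
The hypothesis `hGT` says that the orthogonal projection `S → π` is injective, and `hT` that
its differential `T_ξ S → π` is an isomorphism at each point. The Jacobian of that differential is
`|(T_ξ S)^⊥ ∧ π|`: the Gram matrix defining the wedge norm has identity diagonal blocks, and its two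
Schur complements are the Gram matrices of the projections `π → T_ξ S` and `(T_ξ S)^⊥ → π^⊥`
(`wedgeNorm_eq_normDet`, `wedgeNorm_orthogonal_mul_normDet_graphMap`,
`wedgeNorm_orthogonal_eq_normDet`). So `S` is a graph over a subset of `π`, and surface measure is
`K = 1 / |(T_ξ S)^⊥ ∧ π|` times the Lebesgue measure of the projection
(`IsC1Submanifold.surfaceMeasure_eq_withDensity`). This area formula is proved by linearisation: near
`ξ₀` the chords of `S` are close to vectors of `T_{ξ₀} S`
(`IsC1Submanifold.exists_nhds_chord_estimate`), hence projecting to `π` and lifting to `T_{ξ₀} S`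
distorts Hausdorff measure by a factor close to `1`; passing to the limit, the same estimate holds
for tangent vectors and makes the tangent spaces continuous in `ξ`. Measures that agree locally up to
factors arbitrarily close to `1` are equal.

For the first identity, the area formula turns the restriction of the extension operator to `π + y`
into the Fourier transform on `π` of a function of modulus `K |g|` supported on the projection of `S`;
the phase `exp(-2πi y·ξ)` is the only trace of `y`. Plancherel's theorem, valid in `[0, ∞]` for
integrable functions (`lintegral_enorm_fourier_sq`), gives `∫ K² |g|²` over the projection, which is
`∫_S K |g|² dσ`.

For the second identity, the projection to `π^⊥` maps Lebesgue measure on the plane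
`(T_ξ S)^⊥ + y` to `K(ξ)` times Lebesgue measure on `π^⊥`, independently of `y`. Integrating against
`ν` leaves only its marginal `|g|² dσ`
(`IsC1Submanifold.planeTransformMeasure_adjointPlaneTransform`). This needs the plane measures to
depend measurably on the plane (`AffinePlane.measurable_lebesgue`) and the Gauss map to be measurable
(`IsC1Submanifold.measurable_gaussMap`).
-/

namespace KPlane

/-! ### Measures that agree locally up to factors close to one -/

section LocalComparison

variable {X : Type*} [TopologicalSpace X] [SecondCountableTopology X] [MeasurableSpace X]
  [OpensMeasurableSpace X]

/-- Countably many of the neighbourhoods cover the space, and `A` is cut into disjoint pieces lying in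
one of them each. -/
theorem measure_le_of_locally_le {μ ν : Measure X}
    (h : ∀ x, ∃ U ∈ 𝓝 x, ∀ A ⊆ U, MeasurableSet A → μ A ≤ ν A) : μ ≤ ν := by
  choose U hU hle using h
  obtain ⟨s, hs, hcov⟩ := TopologicalSpace.countable_cover_nhds fun x => interior_mem_nhds.2 (hU x)
  refine Measure.le_iff.2 fun A hA => ?_
  obtain rfl | hne := s.eq_empty_or_nonempty
  · have : A = ∅ := by
      rw [← subset_empty_iff]
      exact (subset_univ A).trans (by simpa using hcov.symm.subset)
    simp [this]
  obtain ⟨t, ht⟩ := hs.exists_eq_range hne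
  set V : ℕ → Set X := fun i => interior (U (t i))
  have hVm : ∀ i, MeasurableSet (disjointed V i) :=
    MeasurableSet.disjointed fun i => isOpen_interior.measurableSet
  have hA' : A = ⋃ i, A ∩ disjointed V i := by
    rw [← inter_iUnion, iUnion_disjointed]
    have : ⋃ i, V i = univ := by
      rw [← hcov, ht, biUnion_range]
    rw [this, inter_univ]
  have hd : Pairwise (Function.onFun Disjoint fun i => A ∩ disjointed V i) := fun i j hij =>
    (disjoint_disjointed V hij).mono inter_subset_right inter_subset_right
  rw [hA', measure_iUnion hd fun i => hA.inter (hVm i),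
    measure_iUnion hd fun i => hA.inter (hVm i)]
  exact ENNReal.tsum_le_tsum fun i => hle (t i) _
    (inter_subset_right.trans ((disjointed_subset V i).trans interior_subset)) (hA.inter (hVm i))

/-- Comparison up to every factor `c > 1` near each point, the neighbourhood depending on `c`,
already gives equality. -/
theorem measure_eq_of_locally_le_smul {μ ν : Measure X}
    (h : ∀ c : ℝ≥0∞, 1 < c → c ≠ ∞ → ∀ x, ∃ U ∈ 𝓝 x, ∀ A ⊆ U, MeasurableSet A →
      μ A ≤ c * ν A ∧ ν A ≤ c * μ A) : μ = ν := by
  have key : ∀ μ ν : Measure X, (∀ c : ℝ≥0∞, 1 < c → c ≠ ∞ → μ ≤ c • ν) → μ ≤ ν := by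
    intro μ ν hc
    refine Measure.le_iff.2 fun A _ => ?_
    refine ENNReal.le_of_forall_pos_le_add fun ε hε hfin => ?_
    have hlim : Tendsto (fun c : ℝ≥0∞ => c * ν A) (𝓝[>] 1) (𝓝 (1 * ν A)) :=
      (ENNReal.Tendsto.mul_const tendsto_id (Or.inl one_ne_zero)).mono_left nhdsWithin_le_nhds
    have hle : μ A ≤ 1 * ν A := by
      have : (𝓝[>] (1 : ℝ≥0∞)).NeBot := nhdsGT_neBot_of_exists_gt ⟨2, by norm_num⟩
      refine ge_of_tendsto hlim ?_
      filter_upwards [self_mem_nhdsWithin,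
        nhdsWithin_le_nhds (Iio_mem_nhds (ENNReal.one_lt_top))] with c h1 h2
      exact hc c h1 (ne_of_lt h2) A
    rw [one_mul] at hle
    exact hle.trans le_self_add
  refine le_antisymm (key μ ν fun c h1 h2 => measure_le_of_locally_le fun x => ?_)
    (key ν μ fun c h1 h2 => measure_le_of_locally_le fun x => ?_)
  · obtain ⟨U, hU, hA⟩ := h c h1 h2 x
    exact ⟨U, hU, fun A hAU hAm => by simpa using (hA A hAU hAm).1⟩
  · obtain ⟨U, hU, hA⟩ := h c h1 h2 x
    exact ⟨U, hU, fun A hAU hAm => by simpa using (hA A hAU hAm).2⟩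

end LocalComparison

/-! ### Plancherel's theorem for integrable functions -/

section Plancherel

open scoped SchwartzMap FourierTransform

variable {V : Type*} [NormedAddCommGroup V] [InnerProductSpace ℝ V] [FiniteDimensional ℝ V]
  [MeasurableSpace V] [BorelSpace V]

theorem ae_eq_of_integral_schwartz_mul_eq {u v : V → ℂ} (hu : LocallyIntegrable u)
    (hv : LocallyIntegrable v) (h : ∀ φ : 𝓢(V, ℂ), ∫ x, φ x * u x = ∫ x, φ x * v x) :
    u =ᵐ[volume] v := by
  refine ae_eq_of_integral_contDiff_smul_eq hu hv fun φ hφ hc => ?_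
  have hg₁ : HasCompactSupport (Complex.ofRealCLM ∘ φ) := hc.comp_left rfl
  have hg₂ : ContDiff ℝ (⊤ : ℕ∞) (Complex.ofRealCLM ∘ φ) := by fun_prop
  simpa using h (hg₁.toSchwartzMap hg₂)

theorem integral_fourier_schwartz_mul_eq {f : V → ℂ} (hf : Integrable f) (φ : 𝓢(V, ℂ)) :
    ∫ x, φ x * 𝓕 f x = ∫ x, 𝓕 φ x * f x := by
  have := VectorFourier.integral_fourierIntegral_smul_eq_flip (e := Real.fourierChar)
    (μ := (volume : Measure V)) (ν := (volume : Measure V)) (L := innerₗ V) (f := φ) (g := f)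
    Real.continuous_fourierChar continuous_inner φ.integrable hf
  rw [flip_innerₗ] at this
  exact this.symm

/-- Plancherel's theorem for integrable functions, in `[0, ∞]`: the Fourier transform of an
integrable function is square integrable only if the function is. -/
theorem lintegral_enorm_fourier_sq {f : V → ℂ} (hf : Integrable f) :
    ∫⁻ x, ‖𝓕 f x‖ₑ ^ 2 = ∫⁻ x, ‖f x‖ₑ ^ 2 := by
  have hcont : Continuous (𝓕 f) :=
    VectorFourier.fourierIntegral_continuous Real.continuous_fourierChar continuous_inner hf
  have hL2 : ∀ F : Lp ℂ 2 (volume : Measure V), ∀ {u : V → ℂ}, u =ᵐ[volume] F →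
      ∫⁻ x, ‖u x‖ₑ ^ 2 = ‖F‖ₑ ^ 2 := by
    intro F u hu
    have h := eLpNorm_nnreal_pow_eq_lintegral (f := u) (μ := volume) (p := 2) two_ne_zero
    have h' : ‖F‖ₑ = eLpNorm u 2 volume := by
      rw [eLpNorm_congr_ae hu, Lp.enorm_def]
    rw [h']
    simpa using h.symm
  -- If `f` is in `L²`, then `𝓕 f` is its `L²` Fourier transform; if `𝓕 f` is in `L²`, then `f` is the
  -- inverse `L²` Fourier transform of `𝓕 f`. In both cases the two agree as tempered distributions.
  by_cases h2 : MemLp f 2 volume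
  · set F := h2.toLp f
    have hcoe : f =ᵐ[volume] F := h2.coeFn_toLp.symm
    have h𝓕 : 𝓕 f =ᵐ[volume] (𝓕 F : Lp ℂ 2 (volume : Measure V)) := by
      refine ae_eq_of_integral_schwartz_mul_eq hcont.locallyIntegrable
        ((Lp.memLp (E := ℂ) (p := 2) (μ := volume) _).locallyIntegrable one_le_two) fun φ => ?_
      rw [integral_fourier_schwartz_mul_eq hf]
      have := congrArg (fun T => T φ) (Lp.fourier_toTemperedDistribution_eq (E := V) F)
      simp only [TemperedDistribution.fourier_apply, Lp.toTemperedDistribution_apply,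
        smul_eq_mul] at this
      rw [← this]
      refine integral_congr_ae ?_
      filter_upwards [hcoe] with x hx
      rw [hx]
    rw [hL2 _ hcoe, hL2 _ h𝓕, enorm_eq_nnnorm, enorm_eq_nnnorm]
    congr 2
    exact NNReal.eq (Lp.norm_fourier_eq F)
  · have hn : ¬ MemLp (𝓕 f) 2 volume := by
      intro h
      apply h2
      set H := h.toLp (𝓕 f)
      have hcoe : 𝓕 f =ᵐ[volume] H := h.coeFn_toLp.symm
      have : f =ᵐ[volume] (𝓕⁻ H : Lp ℂ 2 (volume : Measure V)) := by
        refine ae_eq_of_integral_schwartz_mul_eq hf.locallyIntegrable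
          ((Lp.memLp (E := ℂ) (p := 2) (μ := volume) _).locallyIntegrable one_le_two) fun φ => ?_
        have h1 := integral_fourier_schwartz_mul_eq hf (𝓕⁻ φ)
        rw [FourierTransform.fourier_fourierInv_eq] at h1
        rw [← h1]
        have := congrArg (fun T => T φ) (Lp.fourierInv_toTemperedDistribution_eq H)
        simp only [TemperedDistribution.fourierInv_apply, Lp.toTemperedDistribution_apply,
          smul_eq_mul] at this
        rw [← this]
        refine integral_congr_ae ?_
        filter_upwards [hcoe] with x hx
        rw [hx]
      exact (memLp_congr_ae this).2 (Lp.memLp _)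
    have htop : ∀ u : V → ℂ, AEStronglyMeasurable u volume → ¬ MemLp u 2 volume →
        ∫⁻ x, ‖u x‖ₑ ^ 2 = ∞ := by
      intro u hu hnu
      have h := eLpNorm_nnreal_pow_eq_lintegral (f := u) (μ := volume) (p := 2) two_ne_zero
      have h' : eLpNorm u 2 volume = ∞ := by
        by_contra hne
        exact hnu ⟨hu, lt_top_iff_ne_top.2 hne⟩
      have h3 : eLpNorm u 2 volume ^ 2 = ∫⁻ x, ‖u x‖ₑ ^ 2 := by simpa using h
      rw [← h3, h']
      simp
    rw [htop _ hcont.aestronglyMeasurable hn, htop _ hf.aestronglyMeasurable h2]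

end Plancherel

/-! ### The wedge norm as a Jacobian of orthogonal projections -/

section LinearAlgebra

variable {n : ℕ}

theorem wedgeNorm_comm (V W : Submodule ℝ (EuclideanSpace ℝ (Fin n))) :
    wedgeNorm V W = wedgeNorm W V := by
  unfold wedgeNorm
  congr 1
  rw [← Matrix.det_submatrix_equiv_self (Equiv.sumComm _ _)]
  congr 1
  ext i j
  rcases i with i | i <;> rcases j with j | j <;> simp [Matrix.gram_apply]

/-- The Gram matrix is `[[1, B], [Bᵀ, 1]]` with `B = ⟨vᵢ, wⱼ⟩`, and its Schur complement `1 - BᵀB`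
is the Gram matrix of the projections of the `wⱼ` to `V^⊥`. -/
theorem wedgeNorm_eq_normDet (V W : Submodule ℝ (EuclideanSpace ℝ (Fin n))) :
    wedgeNorm V W = (Vᗮ.starProjection.toLinearMap ∘ₗ W.subtype).normDet := by
  set v := stdOrthonormalBasis ℝ V
  set w := stdOrthonormalBasis ℝ W
  rw [wedgeNorm, ← Real.sqrt_sq (LinearMap.normDet_nonneg _)]
  congr 1
  have h := LinearMap.normDet_sq_eq_det_gram (Vᗮ.starProjection.toLinearMap ∘ₗ W.subtype) w
  rw [RCLike.ofReal_real_eq_id, id] at h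
  rw [h]
  set B : Matrix (Fin (Module.finrank ℝ V)) (Fin (Module.finrank ℝ W)) ℝ :=
    Matrix.of fun i j => inner ℝ (v i : EuclideanSpace ℝ (Fin n)) (w j) with hB
  have hblock : Matrix.gram ℝ (Sum.elim (fun i => (v i : EuclideanSpace ℝ (Fin n)))
      (fun j => (w j : EuclideanSpace ℝ (Fin n)))) = Matrix.fromBlocks 1 B B.transpose 1 := by
    ext i j
    rcases i with i | i <;> rcases j with j | j
    · simpa [Matrix.gram_apply, Matrix.one_apply] using orthonormal_iff_ite.1 v.orthonormal i j
    · simp [Matrix.gram_apply, hB]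
    · simp [Matrix.gram_apply, hB, real_inner_comm]
    · simpa [Matrix.gram_apply, Matrix.one_apply] using orthonormal_iff_ite.1 w.orthonormal i j
  rw [hblock, Matrix.det_fromBlocks_one₁₁]
  congr 1
  ext i j
  have h1 : inner ℝ (w i : EuclideanSpace ℝ (Fin n)) (w j) = if i = j then (1 : ℝ) else 0 := by
    simpa using orthonormal_iff_ite.1 w.orthonormal i j
  have h2 := OrthonormalBasis.sum_inner_mul_inner v (V.orthogonalProjectionOnto (w i))
    (V.orthogonalProjectionOnto (w j))
  have h3 : ∀ x : EuclideanSpace ℝ (Fin n), ∀ y : V,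
      inner ℝ y (V.orthogonalProjectionOnto x) = inner ℝ (y : EuclideanSpace ℝ (Fin n)) x := by
    intro x y
    rw [Submodule.inner_orthogonalProjectionOnto_eq_of_mem_left]
  have h4 : inner ℝ (V.orthogonalProjectionOnto (w i : EuclideanSpace ℝ (Fin n)))
      (V.orthogonalProjectionOnto (w j : EuclideanSpace ℝ (Fin n))) =
      inner ℝ (w i : EuclideanSpace ℝ (Fin n)) (V.starProjection (w j)) := by
    rw [h3]
    exact Submodule.inner_starProjection_left_eq_right V _ _
  rw [Matrix.gram_apply]
  have h5 : inner ℝ (Vᗮ.starProjection (w i : EuclideanSpace ℝ (Fin n))) (Vᗮ.starProjection (w j)) =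
      inner ℝ (w i : EuclideanSpace ℝ (Fin n)) (w j) -
        inner ℝ (w i : EuclideanSpace ℝ (Fin n)) (V.starProjection (w j)) := by
    rw [Submodule.inner_starProjection_left_eq_right,
      Submodule.starProjection_eq_self_iff.2 (Submodule.starProjection_apply_mem _ _),
      Submodule.starProjection_orthogonal]
    simp [inner_sub_right]
  change _ = inner ℝ (Vᗮ.starProjection (w i : EuclideanSpace ℝ (Fin n))) (Vᗮ.starProjection (w j))
  rw [h5, h1, ← h4, ← h2]
  simp only [Matrix.sub_apply, Matrix.one_apply, Matrix.mul_apply, Matrix.transpose_apply, hB,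
    Matrix.of_apply]
  congr 1
  refine Finset.sum_congr rfl fun l _ => ?_
  rw [h3, real_inner_comm (v l) (V.orthogonalProjectionOnto _), h3, real_inner_comm]

theorem normDet_adjoint_of_finrank_eq {U V : Type*} [NormedAddCommGroup U] [InnerProductSpace ℝ U]
    [FiniteDimensional ℝ U] [NormedAddCommGroup V] [InnerProductSpace ℝ V] [FiniteDimensional ℝ V]
    (h : Module.finrank ℝ U = Module.finrank ℝ V) (f : U →ₗ[ℝ] V) :
    f.adjoint.normDet = f.normDet := by
  let bu := stdOrthonormalBasis ℝ U
  let bv := (stdOrthonormalBasis ℝ V).reindex (finCongr h.symm)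
  rw [f.normDet_eq_norm_det_toMatrix bu bv, f.adjoint.normDet_eq_norm_det_toMatrix bv bu,
    LinearMap.toMatrix_adjoint, Matrix.det_conjTranspose, norm_star]

/-- For `T ∩ π^⊥ = 0` and `dim T = dim π`, the inverse `π → T ⊆ ℝⁿ` of the orthogonal projection
`T → π`: the map whose graph over `π` is `T`. -/
noncomputable def graphMap (T π : Submodule ℝ (EuclideanSpace ℝ (Fin n))) :
    π →L[ℝ] EuclideanSpace ℝ (Fin n) :=
  T.subtypeL ∘L (π.orthogonalProjectionOnto ∘L T.subtypeL).inverse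

variable {T π : Submodule ℝ (EuclideanSpace ℝ (Fin n))}

theorem exists_projection_equiv (h : T ⊓ πᗮ = ⊥)
    (hd : Module.finrank ℝ T = Module.finrank ℝ π) :
    ∃ e : T ≃L[ℝ] π, (∀ t, e t = π.orthogonalProjectionOnto t) ∧
      graphMap T π = T.subtypeL ∘L (e.symm : π →L[ℝ] T) := by
  have hinj : Function.Injective (π.orthogonalProjectionOnto ∘L T.subtypeL).toLinearMap := by
    rw [← LinearMap.ker_eq_bot, LinearMap.ker_eq_bot']
    intro t ht
    have h1 : (t : EuclideanSpace ℝ (Fin n)) ∈ πᗮ :=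
      Submodule.orthogonalProjectionOnto_eq_zero_iff.1 ht
    have h2 : (t : EuclideanSpace ℝ (Fin n)) ∈ T ⊓ πᗮ := ⟨t.2, h1⟩
    rw [h, Submodule.mem_bot] at h2
    exact Subtype.ext h2
  set e := (LinearMap.linearEquivOfInjective _ hinj hd).toContinuousLinearEquiv
  have hc : π.orthogonalProjectionOnto ∘L T.subtypeL = (e : T →L[ℝ] π) := by
    ext t
    rfl
  refine ⟨e, fun t => rfl, ?_⟩
  rw [graphMap, hc, ContinuousLinearMap.inverse_equiv]

theorem graphMap_mem (x : π) : graphMap T π x ∈ T := by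
  simp [graphMap]

theorem orthogonalProjectionOnto_graphMap (h : T ⊓ πᗮ = ⊥)
    (hd : Module.finrank ℝ T = Module.finrank ℝ π) (x : π) :
    π.orthogonalProjectionOnto (graphMap T π x) = x := by
  obtain ⟨e, he, hg⟩ := exists_projection_equiv h hd
  rw [hg]
  simp [← he]

theorem graphMap_orthogonalProjectionOnto (h : T ⊓ πᗮ = ⊥)
    (hd : Module.finrank ℝ T = Module.finrank ℝ π) {t : EuclideanSpace ℝ (Fin n)} (ht : t ∈ T) :
    graphMap T π (π.orthogonalProjectionOnto t) = t := by
  obtain ⟨e, he, hg⟩ := exists_projection_equiv h hd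
  rw [hg, ← he ⟨t, ht⟩]
  simp

theorem norm_le_norm_graphMap (h : T ⊓ πᗮ = ⊥)
    (hd : Module.finrank ℝ T = Module.finrank ℝ π) (x : π) : ‖x‖ ≤ ‖graphMap T π x‖ := by
  conv_lhs => rw [← orthogonalProjectionOnto_graphMap h hd x]
  exact Submodule.norm_orthogonalProjectionOnto_apply_le π _

theorem normDet_graphMap_pos (h : T ⊓ πᗮ = ⊥)
    (hd : Module.finrank ℝ T = Module.finrank ℝ π) :
    0 < (graphMap T π).toLinearMap.normDet := by
  refine lt_of_le_of_ne (LinearMap.normDet_nonneg _) (Ne.symm ?_)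
  rw [Ne, LinearMap.normDet_eq_zero_iff_ker_ne_bot, not_not, LinearMap.ker_eq_bot]
  exact Function.LeftInverse.injective (g := π.orthogonalProjectionOnto)
    (orthogonalProjectionOnto_graphMap h hd)

/-- `|T^⊥ ∧ π|` is the Jacobian of the orthogonal projection `T → π`. -/
theorem wedgeNorm_orthogonal_mul_normDet_graphMap (h : T ⊓ πᗮ = ⊥)
    (hd : Module.finrank ℝ T = Module.finrank ℝ π) :
    wedgeNorm Tᗮ π * (graphMap T π).toLinearMap.normDet = 1 := by
  obtain ⟨e, he, hg⟩ := exists_projection_equiv h hd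
  have h1 : (graphMap T π).toLinearMap.normDet = e.symm.toLinearEquiv.toLinearMap.normDet := by
    rw [← LinearMap.normDet_codRestrict (p := T) (f := (graphMap T π).toLinearMap) graphMap_mem]
    congr 1
    ext x
    simp [hg]
  have h2 : wedgeNorm Tᗮ π = (T.orthogonalProjectionOnto.toLinearMap ∘ₗ π.subtype).normDet := by
    rw [wedgeNorm_eq_normDet]
    simp_rw [Submodule.orthogonal_orthogonal]
    rw [← LinearMap.normDet_codRestrict (p := T)
      (f := T.starProjection.toLinearMap ∘ₗ π.subtype) fun x => by simp]
    rfl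
  have h3 : (T.orthogonalProjectionOnto.toLinearMap ∘ₗ π.subtype) =
      e.toLinearEquiv.toLinearMap.adjoint := by
    refine (LinearMap.eq_adjoint_iff _ _).2 fun x y => ?_
    simp only [LinearMap.coe_comp, ContinuousLinearMap.coe_coe, Function.comp_apply,
      Submodule.coe_subtype]
    change _ = inner ℝ x (e y)
    rw [he, Submodule.inner_orthogonalProjectionOnto_eq_of_mem_left,
      Submodule.inner_orthogonalProjectionOnto_eq_of_mem_right]
  rw [h1, h2, h3, normDet_adjoint_of_finrank_eq hd, ← LinearMap.normDet_comp_of_finrank_eq _ _ hd.symm]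
  convert LinearMap.normDet_id (𝕜 := ℝ) (U := π)
  ext x
  simp

/-- `|T^⊥ ∧ π|` is also the Jacobian of the orthogonal projection `T^⊥ → π^⊥`. -/
theorem wedgeNorm_orthogonal_eq_normDet (T π : Submodule ℝ (EuclideanSpace ℝ (Fin n))) :
    wedgeNorm Tᗮ π = (πᗮ.orthogonalProjectionOnto.toLinearMap ∘ₗ Tᗮ.subtype).normDet := by
  rw [wedgeNorm_comm, wedgeNorm_eq_normDet,
    ← LinearMap.normDet_codRestrict (p := πᗮ)
      (f := πᗮ.starProjection.toLinearMap ∘ₗ Tᗮ.subtype) fun x => by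
        exact Submodule.starProjection_apply_mem _ _]
  rfl

end LinearAlgebra

/-! ### Chords and tangent spaces of `C¹` submanifolds -/

section Submanifold

variable {n k : ℕ} {S : Set (EuclideanSpace ℝ (Fin n))}

theorem IsC1Submanifold.isLocallyClosed (hS : IsC1Submanifold k S) : IsLocallyClosed S := by
  refine ((isLocallyClosed_tfae S).out 0 2).2 fun ξ hξ => ?_
  obtain ⟨Φ, V, hsrc, -, -, -, hSV⟩ := hS ξ hξ
  refine ⟨Φ.source, Φ.open_source.mem_nhds hsrc, ?_⟩
  have : (Subtype.val ⁻¹' S : Set Φ.source) = (fun x : Φ.source => Φ x) ⁻¹' (V : Set _) := by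
    ext x
    exact hSV x x.2
  rw [this]
  exact (Submodule.closed_of_finiteDimensional V).preimage
    (continuousOn_iff_continuous_domRestrict.1 Φ.continuousOn)

theorem IsC1Submanifold.measurableSet (hS : IsC1Submanifold k S) : MeasurableSet S := by
  obtain ⟨U, Z, hU, hZ, rfl⟩ := hS.isLocallyClosed
  exact hU.measurableSet.inter hZ.measurableSet

/-- A flattening chart at `ξ`, with its derivative `A` and the inverse `D` of that derivative: the
tangent space is `D V`, and each of its vectors is itself the velocity of a curve in `S`. -/
theorem IsC1Submanifold.exists_chart_deriv (hS : IsC1Submanifold k S)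
    {ξ : EuclideanSpace ℝ (Fin n)} (hξ : ξ ∈ S) :
    ∃ (Φ : EuclideanSpace ℝ (Fin n) → EuclideanSpace ℝ (Fin n))
      (V : Submodule ℝ (EuclideanSpace ℝ (Fin n)))
      (A D : EuclideanSpace ℝ (Fin n) →L[ℝ] EuclideanSpace ℝ (Fin n)),
      HasStrictFDerivAt Φ A ξ ∧ (∀ v, D (A v) = v) ∧ (∀ᶠ x in 𝓝 ξ, x ∈ S → Φ x ∈ V) ∧
      tangentSpaceAt S ξ = V.map D.toLinearMap ∧
      ∀ w ∈ V, ∃ γ : ℝ → EuclideanSpace ℝ (Fin n),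
        γ 0 = ξ ∧ HasDerivAt γ (D w) 0 ∧ ∀ᶠ t in 𝓝 (0 : ℝ), γ t ∈ S := by
  obtain ⟨Φ, V, hsrc, hV, hΦ, hΨ, hSV⟩ := hS ξ hξ
  have htgt : Φ ξ ∈ Φ.target := Φ.map_source hsrc
  have sΦ : HasStrictFDerivAt Φ (fderiv ℝ Φ ξ) ξ :=
    (hΦ.contDiffAt (Φ.open_source.mem_nhds hsrc)).hasStrictFDerivAt one_ne_zero
  have dΨ : HasFDerivAt Φ.symm (fderiv ℝ Φ.symm (Φ ξ)) (Φ ξ) :=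
    ((hΨ.contDiffAt (Φ.open_target.mem_nhds htgt)).differentiableAt one_ne_zero).hasFDerivAt
  set A := fderiv ℝ Φ ξ
  set D := fderiv ℝ Φ.symm (Φ ξ)
  have hDA : ∀ v, D (A v) = v := by
    have h1 : HasFDerivAt (Φ.symm ∘ Φ) (D.comp A) ξ := dΨ.comp ξ sΦ.hasFDerivAt
    have h2 : HasFDerivAt (Φ.symm ∘ Φ) (ContinuousLinearMap.id ℝ _) ξ :=
      (hasFDerivAt_id ξ).congr_of_eventuallyEq (Φ.eventually_left_inverse hsrc)
    intro v
    exact congrArg (fun L => L v) (h1.unique h2)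
  have hcurve : ∀ w ∈ V, ∃ γ : ℝ → EuclideanSpace ℝ (Fin n),
      γ 0 = ξ ∧ HasDerivAt γ (D w) 0 ∧ ∀ᶠ t in 𝓝 (0 : ℝ), γ t ∈ S := by
    intro w hw
    refine ⟨fun t => Φ.symm (Φ ξ + t • w), by simp [Φ.left_inv hsrc], ?_, ?_⟩
    · have hl : HasDerivAt (fun t : ℝ => Φ ξ + t • w) w 0 := by
        simpa using ((hasDerivAt_id (0 : ℝ)).smul_const w).const_add (Φ ξ)
      have dΨ' : HasFDerivAt Φ.symm D (Φ ξ + (0 : ℝ) • w) := by simpa using dΨ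
      exact dΨ'.comp_hasDerivAt (0 : ℝ) hl
    · have hc : ContinuousAt (fun t : ℝ => Φ ξ + t • w) 0 := by fun_prop
      have hs : ∀ᶠ t in 𝓝 (0 : ℝ), Φ ξ + t • w ∈ Φ.target :=
        hc.eventually_mem (by simpa using Φ.open_target.mem_nhds htgt)
      filter_upwards [hs] with t ht
      rw [hSV _ (Φ.map_target ht), Φ.right_inv ht]
      exact V.add_mem ((hSV _ hsrc).1 hξ) (V.smul_mem t hw)
  have hsurj : Function.Surjective D.toLinearMap := fun v => ⟨A v, hDA v⟩
  have hinj : Function.Injective D.toLinearMap := LinearMap.injective_iff_surjective.2 hsurj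
  refine ⟨Φ, V, A, D, sΦ, hDA, ?_, ?_, hcurve⟩
  · filter_upwards [Φ.open_source.mem_nhds hsrc] with x hx using (hSV x hx).1
  · refine (Submodule.eq_of_le_of_finrank_eq ?_ ?_).symm
    · rintro _ ⟨w, hw, rfl⟩
      exact Submodule.subset_span (hcurve w hw)
    · rw [← (Submodule.equivMapOfInjective _ hinj V).finrank_eq, hV,
        hS.finrank_tangentSpaceAt hξ]

theorem IsC1Submanifold.exists_curve (hS : IsC1Submanifold k S)
    {ξ v : EuclideanSpace ℝ (Fin n)} (hξ : ξ ∈ S) (hv : v ∈ tangentSpaceAt S ξ) :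
    ∃ γ : ℝ → EuclideanSpace ℝ (Fin n),
      γ 0 = ξ ∧ HasDerivAt γ v 0 ∧ ∀ᶠ t in 𝓝 (0 : ℝ), γ t ∈ S := by
  obtain ⟨Φ, V, A, D, -, -, -, hT, hcurve⟩ := hS.exists_chart_deriv hξ
  rw [hT] at hv
  obtain ⟨w, hw, rfl⟩ := hv
  exact hcurve w hw

/-- Chords of `S` between points near `ξ₀` are tangent at `ξ₀` up to a small relative error. -/
theorem IsC1Submanifold.exists_nhds_chord_close (hS : IsC1Submanifold k S)
    {ξ₀ : EuclideanSpace ℝ (Fin n)} (hξ₀ : ξ₀ ∈ S) {δ : ℝ} (hδ : 0 < δ) :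
    ∃ U ∈ 𝓝 ξ₀, ∀ ξ ∈ U ∩ S, ∀ η ∈ U ∩ S, ∃ t ∈ tangentSpaceAt S ξ₀,
      ‖(ξ - η) - t‖ ≤ δ * ‖ξ - η‖ := by
  obtain ⟨Φ, V, A, D, hA, hDA, hV, hT, -⟩ := hS.exists_chart_deriv hξ₀
  have hc : 0 < δ / (‖D‖ + 1) := by positivity
  have h := hA.isLittleO.def hc
  rw [nhds_prod_eq] at h
  obtain ⟨U₁, hU₁, hU₁'⟩ := Filter.eventually_prod_self_iff'.1 h
  refine ⟨U₁ ∩ {x | x ∈ S → Φ x ∈ V}, inter_mem hU₁ hV, ?_⟩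
  rintro ξ ⟨⟨hξ1, hξ2⟩, hξS⟩ η ⟨⟨hη1, hη2⟩, hηS⟩
  refine ⟨D (Φ ξ - Φ η), ?_, ?_⟩
  · rw [hT]
    exact ⟨_, V.sub_mem (hξ2 hξS) (hη2 hηS), rfl⟩
  · have h1 : (ξ - η) - D (Φ ξ - Φ η) = - D (Φ ξ - Φ η - A (ξ - η)) := by
      rw [map_sub D (Φ ξ - Φ η), hDA]
      abel
    rw [h1, norm_neg]
    have h2 := hU₁' ξ hξ1 η hη1
    simp only at h2
    calc ‖D (Φ ξ - Φ η - A (ξ - η))‖ ≤ ‖D‖ * ‖Φ ξ - Φ η - A (ξ - η)‖ := D.le_opNorm _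
      _ ≤ (‖D‖ + 1) * (δ / (‖D‖ + 1) * ‖ξ - η‖) := by
        gcongr
        linarith
      _ = δ * ‖ξ - η‖ := by
        field_simp

variable {π : Submodule ℝ (EuclideanSpace ℝ (Fin n))}

/-- Near `ξ₀` the chords of `S` are, relative to the length of their projections to `π`, close to
the corresponding vectors of the tangent space at `ξ₀`. -/
theorem IsC1Submanifold.exists_nhds_chord_estimate (hS : IsC1Submanifold k S)
    (hπ : Module.finrank ℝ π = k) {ξ₀ : EuclideanSpace ℝ (Fin n)} (hξ₀ : ξ₀ ∈ S)
    (hT : tangentSpaceAt S ξ₀ ⊓ πᗮ = ⊥) {ε : ℝ} (hε : 0 < ε) :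
    ∃ U, IsOpen U ∧ ξ₀ ∈ U ∧ ∀ ξ ∈ U ∩ S, ∀ η ∈ U ∩ S,
      ‖(ξ - η) - graphMap (tangentSpaceAt S ξ₀) π (π.orthogonalProjectionOnto (ξ - η))‖ ≤
        ε * ‖π.orthogonalProjectionOnto (ξ - η)‖ := by
  have hd : Module.finrank ℝ (tangentSpaceAt S ξ₀) = Module.finrank ℝ π := by
    rw [hS.finrank_tangentSpaceAt hξ₀, hπ]
  set R := graphMap (tangentSpaceAt S ξ₀) π
  -- The first bound on `δ'` gives `‖w‖ ≤ 2 ‖R‖ ‖P w‖` for chords `w`; the second one turns the error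
  -- `δ' ‖w‖` into at most `ε ‖P w‖`.
  set δ' := min (1 / 2) (ε / (2 * (‖R‖ + 1)))
  have hδ'pos : 0 < δ' := by positivity
  have hδ1 : δ' ≤ 1 / 2 := min_le_left _ _
  have hδ2 : δ' * (2 * (‖R‖ + 1)) ≤ ε := by
    rw [← le_div_iff₀ (by positivity)]
    exact min_le_right _ _
  obtain ⟨U, hU, hchord⟩ := hS.exists_nhds_chord_close hξ₀
    (δ := δ' / (1 + ‖R‖)) (by positivity)
  refine ⟨interior U, isOpen_interior, mem_interior_iff_mem_nhds.2 hU, ?_⟩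
  intro ξ hξ η hη
  obtain ⟨t, ht, hle⟩ := hchord ξ ⟨interior_subset hξ.1, hξ.2⟩ η ⟨interior_subset hη.1, hη.2⟩
  set w := ξ - η
  set P := π.orthogonalProjectionOnto
  have hRt : R (P t) = t := graphMap_orthogonalProjectionOnto hT hd ht
  have h1 : w - R (P w) = (w - t) - R (P (w - t)) := by
    rw [map_sub P w t, map_sub R, hRt]
    abel
  have h2 : ‖w - R (P w)‖ ≤ δ' * ‖w‖ := by
    rw [h1]
    have hP : ‖P (w - t)‖ ≤ ‖w - t‖ := Submodule.norm_orthogonalProjectionOnto_apply_le π _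
    calc ‖(w - t) - R (P (w - t))‖ ≤ ‖w - t‖ + ‖R (P (w - t))‖ := norm_sub_le _ _
      _ ≤ ‖w - t‖ + ‖R‖ * ‖w - t‖ := by
        gcongr
        exact (R.le_opNorm _).trans (by gcongr)
      _ = (1 + ‖R‖) * ‖w - t‖ := by ring
      _ ≤ (1 + ‖R‖) * (δ' / (1 + ‖R‖) * ‖w‖) := by gcongr
      _ = δ' * ‖w‖ := by field_simp
  have h3 : ‖w‖ ≤ 2 * ‖R‖ * ‖P w‖ := by
    have : ‖w‖ ≤ ‖w - R (P w)‖ + ‖R (P w)‖ := by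
      simpa using norm_add_le (w - R (P w)) (R (P w))
    have := R.le_opNorm (P w)
    nlinarith [norm_nonneg w]
  calc ‖w - R (P w)‖ ≤ δ' * ‖w‖ := h2
    _ ≤ δ' * (2 * ‖R‖ * ‖P w‖) := by gcongr
    _ ≤ (δ' * (2 * (‖R‖ + 1))) * ‖P w‖ := by
      rw [← mul_assoc]
      gcongr
      linarith
    _ ≤ ε * ‖P w‖ := by gcongr

/-- The chord estimate passes to tangent vectors, which are limits of rescaled chords. -/
theorem IsC1Submanifold.tangent_estimate (hS : IsC1Submanifold k S)
    {U : Set (EuclideanSpace ℝ (Fin n))} (hU : IsOpen U)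
    {R : π →L[ℝ] EuclideanSpace ℝ (Fin n)} {ε : ℝ}
    (hchord : ∀ ξ ∈ U ∩ S, ∀ η ∈ U ∩ S,
      ‖(ξ - η) - R (π.orthogonalProjectionOnto (ξ - η))‖ ≤
        ε * ‖π.orthogonalProjectionOnto (ξ - η)‖)
    {ξ v : EuclideanSpace ℝ (Fin n)} (hξU : ξ ∈ U) (hξ : ξ ∈ S) (hv : v ∈ tangentSpaceAt S ξ) :
    ‖v - R (π.orthogonalProjectionOnto v)‖ ≤ ε * ‖π.orthogonalProjectionOnto v‖ := by
  obtain ⟨γ, h0, hγ, hγS⟩ := hS.exists_curve hξ hv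
  have hslope : Tendsto (slope γ 0) (𝓝[≠] 0) (𝓝 v) := hasDerivAt_iff_tendsto_slope.1 hγ
  have hcl : Continuous fun x : EuclideanSpace ℝ (Fin n) =>
      ‖x - R (π.orthogonalProjectionOnto x)‖ := by fun_prop
  have hcr : Continuous fun x : EuclideanSpace ℝ (Fin n) =>
      ε * ‖π.orthogonalProjectionOnto x‖ := by fun_prop
  refine le_of_tendsto_of_tendsto ((hcl.tendsto v).comp hslope) ((hcr.tendsto v).comp hslope) ?_
  have hγU : ∀ᶠ t in 𝓝 (0 : ℝ), γ t ∈ U :=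
    hγ.continuousAt.eventually_mem (by rw [h0]; exact hU.mem_nhds hξU)
  filter_upwards [nhdsWithin_le_nhds hγU, nhdsWithin_le_nhds hγS] with t htU htS
  have h := hchord (γ t) ⟨htU, htS⟩ ξ ⟨hξU, hξ⟩
  simp only [Function.comp_apply, slope_def_module, h0, sub_zero, map_smul, ← smul_sub, norm_smul]
  rw [mul_left_comm]
  gcongr

theorem IsC1Submanifold.norm_graphMap_sub_le (hS : IsC1Submanifold k S)
    (hπ : Module.finrank ℝ π = k)
    {U : Set (EuclideanSpace ℝ (Fin n))} (hU : IsOpen U)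
    {R : π →L[ℝ] EuclideanSpace ℝ (Fin n)} {ε : ℝ} (hε : 0 ≤ ε)
    (hchord : ∀ ξ ∈ U ∩ S, ∀ η ∈ U ∩ S,
      ‖(ξ - η) - R (π.orthogonalProjectionOnto (ξ - η))‖ ≤
        ε * ‖π.orthogonalProjectionOnto (ξ - η)‖)
    {ξ : EuclideanSpace ℝ (Fin n)} (hξU : ξ ∈ U) (hξ : ξ ∈ S)
    (hT : tangentSpaceAt S ξ ⊓ πᗮ = ⊥) :
    ‖graphMap (tangentSpaceAt S ξ) π - R‖ ≤ ε := by
  have hd : Module.finrank ℝ (tangentSpaceAt S ξ) = Module.finrank ℝ π := by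
    rw [hS.finrank_tangentSpaceAt hξ, hπ]
  refine ContinuousLinearMap.opNorm_le_bound _ hε fun x => ?_
  have h := hS.tangent_estimate hU hchord hξU hξ (graphMap_mem (π := π) x)
  rwa [orthogonalProjectionOnto_graphMap hT hd] at h

/-- The tangent space depends continuously on the point: the tangent estimate at `ξ` relative to `ξ₀`
bounds the distance between the two graph maps. -/
theorem IsC1Submanifold.continuous_graphMap (hS : IsC1Submanifold k S)
    (hπ : Module.finrank ℝ π = k) (hT : ∀ ξ ∈ S, tangentSpaceAt S ξ ⊓ πᗮ = ⊥) :
    Continuous fun ξ : S => graphMap (tangentSpaceAt S ξ) π := by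
  refine continuous_iff_continuousAt.2 fun ξ₀ => ?_
  rw [ContinuousAt]
  refine (Metric.tendsto_nhds (α := π →L[ℝ] EuclideanSpace ℝ (Fin n))).2 fun ε hε => ?_
  obtain ⟨U, hU, hξU, hchord⟩ := hS.exists_nhds_chord_estimate hπ ξ₀.2 (hT _ ξ₀.2) (half_pos hε)
  filter_upwards [(hU.preimage continuous_subtype_val).mem_nhds hξU] with ξ hξ
  exact (dist_eq_norm (E := π →L[ℝ] EuclideanSpace ℝ (Fin n)) _ _).trans_lt ((hS.norm_graphMap_sub_le hπ hU (half_pos hε).le hchord hξ ξ.2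
    (hT _ ξ.2)).trans_lt (half_lt_self hε))

theorem continuous_normDet {U V : Type*} [NormedAddCommGroup U] [InnerProductSpace ℝ U]
    [FiniteDimensional ℝ U] [NormedAddCommGroup V] [InnerProductSpace ℝ V] [CompleteSpace V] :
    Continuous fun f : U →L[ℝ] V => f.toLinearMap.normDet := by
  have : (fun f : U →L[ℝ] V => f.toLinearMap.normDet) =
      fun f => Real.sqrt (Matrix.gram ℝ fun i => f (stdOrthonormalBasis ℝ U i)).det := by
    ext f
    rw [← Real.sqrt_sq (LinearMap.normDet_nonneg _)]
    congr 1
    simpa using LinearMap.normDet_sq_eq_det_gram f.toLinearMap (stdOrthonormalBasis ℝ U)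
  rw [this]
  refine Real.continuous_sqrt.comp (Continuous.matrix_det ?_)
  refine continuous_matrix fun i j => ?_
  simp only [Matrix.gram_apply]
  fun_prop

end Submanifold

/-! ### Hausdorff measure under maps that are Lipschitz or antilipschitz on a set -/

section Hausdorff

open scoped NNReal

variable {X Y : Type*} [EMetricSpace X] [EMetricSpace Y] [MeasurableSpace X] [BorelSpace X]
  [MeasurableSpace Y] [BorelSpace Y] {r : ℝ≥0} {f : X → Y} {A : Set X}

theorem euclideanHausdorffMeasure_image_le (h : LipschitzOnWith r f A) (d : ℕ) :
    Measure.euclideanHausdorffMeasure d (f '' A) ≤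
      (r : ℝ≥0∞) ^ d * Measure.euclideanHausdorffMeasure d A := by
  simp only [Measure.euclideanHausdorffMeasure_def, Measure.smul_apply, ENNReal.smul_def,
    smul_eq_mul]
  rw [mul_left_comm]
  gcongr
  simpa using h.hausdorffMeasure_image_le (d := d) (by positivity)

/-- The antilipschitz hypothesis is only on `A`, so that the map is first restricted to the subtype
`A`, whose inclusion is an isometry. -/
theorem euclideanHausdorffMeasure_le_image (h : AntilipschitzWith r (A.domRestrict f)) (d : ℕ) :
    Measure.euclideanHausdorffMeasure d A ≤
      (r : ℝ≥0∞) ^ d * Measure.euclideanHausdorffMeasure d (f '' A) := by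
  have h1 := h.le_hausdorffMeasure_image (d := d) (by positivity) univ
  rw [image_univ, range_domRestrict, ← isometry_subtype_coe.hausdorffMeasure_image (by simp),
    image_univ, Subtype.range_coe] at h1
  simp only [Measure.euclideanHausdorffMeasure_def, Measure.smul_apply, ENNReal.smul_def,
    smul_eq_mul]
  rw [mul_left_comm]
  gcongr
  simpa using h1

end Hausdorff

/-! ### The area formula for the projection of `S` to `π` -/

section AreaFormula

variable {n k : ℕ} {S : Set (EuclideanSpace ℝ (Fin n))}
  {π : Submodule ℝ (EuclideanSpace ℝ (Fin n))}

/-- The orthogonal projection `S → π`. -/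
noncomputable def projectTo (S : Set (EuclideanSpace ℝ (Fin n)))
    (π : Submodule ℝ (EuclideanSpace ℝ (Fin n))) (ξ : S) : π :=
  π.orthogonalProjectionOnto (ξ : EuclideanSpace ℝ (Fin n))

theorem continuous_projectTo : Continuous (projectTo S π) :=
  π.orthogonalProjectionOnto.continuous.comp continuous_subtype_val

theorem projectTo_injective
    (hGT : ∀ ξ ∈ S, ∀ η ∈ S, Submodule.span ℝ {ξ - η} ⊓ πᗮ = ⊥) :
    Function.Injective (projectTo S π) := by
  intro ξ η h
  have h1 : (ξ : EuclideanSpace ℝ (Fin n)) - η ∈ πᗮ := by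
    rw [← Submodule.orthogonalProjectionOnto_eq_zero_iff, map_sub, sub_eq_zero]
    exact h
  have h2 : (ξ : EuclideanSpace ℝ (Fin n)) - η ∈ Submodule.span ℝ {(ξ : EuclideanSpace ℝ (Fin n)) - η} ⊓ πᗮ :=
    ⟨Submodule.mem_span_singleton_self _, h1⟩
  rw [hGT ξ ξ.2 η η.2, Submodule.mem_bot, sub_eq_zero] at h2
  exact Subtype.ext h2

/-- By the Lusin–Souslin theorem; the hypothesis `hGT` is the injectivity. -/
theorem IsC1Submanifold.measurableEmbedding_projectTo (hS : IsC1Submanifold k S)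
    (hGT : ∀ ξ ∈ S, ∀ η ∈ S, Submodule.span ℝ {ξ - η} ⊓ πᗮ = ⊥) :
    MeasurableEmbedding (projectTo S π) :=
  haveI := hS.measurableSet.standardBorel
  continuous_projectTo.measurable.measurableEmbedding (projectTo_injective hGT)

/-- The Jacobian of the inverse of the orthogonal projection `S → π`. -/
noncomputable def inverseJacobian (S : Set (EuclideanSpace ℝ (Fin n)))
    (π : Submodule ℝ (EuclideanSpace ℝ (Fin n))) (ξ : S) : ℝ :=
  (graphMap (tangentSpaceAt S ξ) π).toLinearMap.normDet

theorem IsC1Submanifold.continuous_inverseJacobian (hS : IsC1Submanifold k S)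
    (hπ : Module.finrank ℝ π = k) (hT : ∀ ξ ∈ S, tangentSpaceAt S ξ ⊓ πᗮ = ⊥) :
    Continuous (inverseJacobian S π) :=
  continuous_normDet.comp (hS.continuous_graphMap hπ hT)

theorem IsC1Submanifold.inverseJacobian_pos (hS : IsC1Submanifold k S)
    (hπ : Module.finrank ℝ π = k) (hT : ∀ ξ ∈ S, tangentSpaceAt S ξ ⊓ πᗮ = ⊥) (ξ : S) :
    0 < inverseJacobian S π ξ :=
  normDet_graphMap_pos (hT ξ ξ.2) (by rw [hS.finrank_tangentSpaceAt ξ.2, hπ])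

theorem IsC1Submanifold.inv_ofReal_wedgeNorm (hS : IsC1Submanifold k S)
    (hπ : Module.finrank ℝ π = k) (hT : ∀ ξ ∈ S, tangentSpaceAt S ξ ⊓ πᗮ = ⊥) (ξ : S) :
    (ENNReal.ofReal (wedgeNorm (tangentSpaceAt S ξ)ᗮ π))⁻¹ =
      ENNReal.ofReal (inverseJacobian S π ξ) := by
  have h := wedgeNorm_orthogonal_mul_normDet_graphMap (hT ξ ξ.2)
    (by rw [hS.finrank_tangentSpaceAt ξ.2, hπ])
  have hpos := hS.inverseJacobian_pos hπ hT ξ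
  have hw : wedgeNorm (tangentSpaceAt S ξ)ᗮ π = (inverseJacobian S π ξ)⁻¹ :=
    eq_inv_of_mul_eq_one_left h
  rw [hw, ENNReal.ofReal_inv_of_pos hpos, inv_inv]

/-- Near each point the surface measure is, up to a factor close to `1`, the Lebesgue measure of the
projection to `π` times the Jacobian at that point. -/
theorem IsC1Submanifold.exists_nhds_surfaceMeasure_estimate (hS : IsC1Submanifold k S)
    (hπ : Module.finrank ℝ π = k) (hT : ∀ ξ ∈ S, tangentSpaceAt S ξ ⊓ πᗮ = ⊥)
    {r : NNReal} (hr : 1 < r) (ξ₀ : S) :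
    ∃ U ∈ 𝓝 ξ₀, ∀ A ⊆ U,
      surfaceMeasure k S A ≤ (r : ℝ≥0∞) ^ k *
        (ENNReal.ofReal (inverseJacobian S π ξ₀) * volume (projectTo S π '' A)) ∧
      ENNReal.ofReal (inverseJacobian S π ξ₀) * volume (projectTo S π '' A) ≤
        (r : ℝ≥0∞) ^ k * surfaceMeasure k S A := by
  have hd : Module.finrank ℝ (tangentSpaceAt S ξ₀) = Module.finrank ℝ π := by
    rw [hS.finrank_tangentSpaceAt ξ₀.2, hπ]
  have hr' : (1 : ℝ) < r := by exact_mod_cast hr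
  set R := graphMap (tangentSpaceAt S ξ₀) π
  obtain ⟨U, hU, hξU, hchord⟩ := hS.exists_nhds_chord_estimate hπ ξ₀.2 (hT _ ξ₀.2)
    -- With this `ε` both `1 + ε ≤ r` and `(1 - ε)⁻¹ ≤ r` hold.
    (ε := 1 - (r : ℝ)⁻¹) (by rw [sub_pos]; exact inv_lt_one_of_one_lt₀ hr')
  set f : S → EuclideanSpace ℝ (Fin n) := fun ξ => R (projectTo S π ξ) with hf
  have hsub : ∀ ξ η : S, f ξ - f η =
      R (π.orthogonalProjectionOnto ((ξ : EuclideanSpace ℝ (Fin n)) - η)) := by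
    intro ξ η
    simp [hf, projectTo]
  have hbound : ∀ ξ η : S, (ξ : EuclideanSpace ℝ (Fin n)) ∈ U → (η : EuclideanSpace ℝ (Fin n)) ∈ U →
      dist (f ξ) (f η) ≤ r * dist ξ η ∧ dist ξ η ≤ r * dist (f ξ) (f η) := by
    intro ξ η hξ hη
    have h1 := hchord ξ ⟨hξ, ξ.2⟩ η ⟨hη, η.2⟩
    rw [dist_eq_norm (f ξ), hsub, Subtype.dist_eq, dist_eq_norm]
    set w := (ξ : EuclideanSpace ℝ (Fin n)) - η
    set p := π.orthogonalProjectionOnto w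
    have h2 : ‖p‖ ≤ ‖R p‖ := norm_le_norm_graphMap (hT _ ξ₀.2) hd p
    have h3 : ‖w - R p‖ ≤ (1 - (r : ℝ)⁻¹) * ‖R p‖ := h1.trans <| by
      gcongr
      rw [sub_nonneg]
      exact (inv_lt_one_of_one_lt₀ hr').le
    have h4 : ‖R p‖ ≤ ‖w‖ + ‖w - R p‖ := by
      have := norm_sub_le w (w - R p)
      simpa using this
    have h5 : ‖w‖ ≤ ‖R p‖ + ‖w - R p‖ := by
      have := norm_add_le (R p) (w - R p)
      simpa using this
    have hrr : (r : ℝ) * (r : ℝ)⁻¹ = 1 := mul_inv_cancel₀ (by positivity)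
    constructor
    · have h6 : (r : ℝ)⁻¹ * ‖R p‖ ≤ ‖w‖ := by linarith
      calc ‖R p‖ = r * ((r : ℝ)⁻¹ * ‖R p‖) := by rw [← mul_assoc, hrr, one_mul]
        _ ≤ r * ‖w‖ := by gcongr
    · have h7 : 2 - (r : ℝ)⁻¹ ≤ r := by
        have : 0 < (r : ℝ)⁻¹ := by positivity
        nlinarith [sq_nonneg ((r : ℝ) - 1)]
      calc ‖w‖ ≤ (2 - (r : ℝ)⁻¹) * ‖R p‖ := by linarith
        _ ≤ r * ‖R p‖ := by gcongr
  refine ⟨Subtype.val ⁻¹' U, (hU.preimage continuous_subtype_val).mem_nhds hξU, fun A hA => ?_⟩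
  have hvol : Measure.euclideanHausdorffMeasure k (f '' A) =
      ENNReal.ofReal (inverseJacobian S π ξ₀) * volume (projectTo S π '' A) := by
    have := LinearMap.euclideanHausdorffMeasure_image_eq_normDet_mul_volume R.toLinearMap
      (projectTo S π '' A)
    rw [image_image, hπ] at this
    exact this
  rw [← hvol]
  constructor
  · refine euclideanHausdorffMeasure_le_image (AntilipschitzWith.of_le_mul_dist fun ξ η => ?_) k
    exact (hbound ξ η (hA ξ.2) (hA η.2)).2
  · refine euclideanHausdorffMeasure_image_le (LipschitzOnWith.of_dist_le_mul fun ξ hξ η hη => ?_) k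
    exact (hbound ξ η (hA hξ) (hA hη)).1

/-- The area formula for the inverse of the injective orthogonal projection `S → π`. -/
theorem IsC1Submanifold.surfaceMeasure_eq_withDensity (hS : IsC1Submanifold k S)
    (hπ : Module.finrank ℝ π = k) (hT : ∀ ξ ∈ S, tangentSpaceAt S ξ ⊓ πᗮ = ⊥)
    (hGT : ∀ ξ ∈ S, ∀ η ∈ S, Submodule.span ℝ {ξ - η} ⊓ πᗮ = ⊥) :
    surfaceMeasure k S = ((volume : Measure π).comap (projectTo S π)).withDensity
      (fun ξ => ENNReal.ofReal (inverseJacobian S π ξ)) := by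
  have he := hS.measurableEmbedding_projectTo hGT
  have hK := hS.continuous_inverseJacobian hπ hT
  refine measure_eq_of_locally_le_smul fun c hc hctop ξ₀ => ?_
  -- A factor `r > 1` with `r ^ (k + 1) ≤ c`; one power absorbs the oscillation of the Jacobian.
  obtain ⟨r, hr, hrc⟩ : ∃ r : NNReal, 1 < r ∧ (r : ℝ≥0∞) ^ k * r ≤ c := by
    have hcont : Tendsto (fun r : NNReal => (r : ℝ≥0∞) ^ k * r) (𝓝[>] 1) (𝓝 1) := by
      have : Continuous fun r : NNReal => ((r ^ k * r : NNReal) : ℝ≥0∞) :=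
        ENNReal.continuous_coe.comp (by fun_prop)
      have h := (this.tendsto 1).mono_left (nhdsWithin_le_nhds (s := Ioi 1))
      simpa using h
    obtain ⟨r, h1, h2⟩ := ((hcont.eventually (Iio_mem_nhds hc)).and self_mem_nhdsWithin).exists
    exact ⟨r, h2, le_of_lt h1⟩
  have hr' : (1 : ℝ) < r := by exact_mod_cast hr
  have hK0 := hS.inverseJacobian_pos hπ hT ξ₀
  obtain ⟨U, hU, hest⟩ := hS.exists_nhds_surfaceMeasure_estimate hπ hT hr ξ₀
  have hup : ∀ᶠ ξ in 𝓝 ξ₀, inverseJacobian S π ξ < r * inverseJacobian S π ξ₀ :=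
    hK.continuousAt.eventually_lt_const (lt_mul_of_one_lt_left hK0 hr')
  have hlo : ∀ᶠ ξ in 𝓝 ξ₀, inverseJacobian S π ξ₀ < r * inverseJacobian S π ξ :=
    (hK.const_mul (r : ℝ)).continuousAt.eventually_const_lt (lt_mul_of_one_lt_left hK0 hr')
  refine ⟨U ∩ ({ξ | inverseJacobian S π ξ < r * inverseJacobian S π ξ₀} ∩
    {ξ | inverseJacobian S π ξ₀ < r * inverseJacobian S π ξ}),
    inter_mem hU (inter_mem hup hlo), fun A hA hAm => ?_⟩
  obtain ⟨h1, h2⟩ := hest A fun x hx => (hA hx).1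
  rw [withDensity_apply _ hAm]
  have hτ : (volume : Measure π).comap (projectTo S π) A = volume (projectTo S π '' A) :=
    he.comap_apply _ _
  have hrof : ∀ x : ℝ, ENNReal.ofReal (r * x) = r * ENNReal.ofReal x := fun x => by
    rw [ENNReal.ofReal_mul (by positivity), ENNReal.ofReal_coe_nnreal]
  set τ := (volume : Measure π).comap (projectTo S π)
  have h3 : ENNReal.ofReal (inverseJacobian S π ξ₀) * τ A ≤
      r * ∫⁻ ξ in A, ENNReal.ofReal (inverseJacobian S π ξ) ∂τ := by
    rw [← lintegral_const_mul _ hK.measurable.ennreal_ofReal, ← setLIntegral_const]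
    refine setLIntegral_mono' hAm fun ξ hξ => ?_
    rw [← hrof]
    exact ENNReal.ofReal_le_ofReal (hA hξ).2.2.le
  have h4 : ∫⁻ ξ in A, ENNReal.ofReal (inverseJacobian S π ξ) ∂τ ≤
      r * (ENNReal.ofReal (inverseJacobian S π ξ₀) * τ A) := by
    rw [← mul_assoc, ← hrof, ← setLIntegral_const]
    exact setLIntegral_mono' hAm fun ξ hξ => ENNReal.ofReal_le_ofReal (hA hξ).2.1.le
  rw [← hτ] at h1 h2
  constructor
  · calc surfaceMeasure k S A
        ≤ (r : ℝ≥0∞) ^ k * (r * ∫⁻ ξ in A, ENNReal.ofReal (inverseJacobian S π ξ) ∂τ) := by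
          exact h1.trans (by gcongr)
      _ ≤ c * ∫⁻ ξ in A, ENNReal.ofReal (inverseJacobian S π ξ) ∂τ := by
          rw [← mul_assoc]
          gcongr
  · calc ∫⁻ ξ in A, ENNReal.ofReal (inverseJacobian S π ξ) ∂τ
        ≤ r * ((r : ℝ≥0∞) ^ k * surfaceMeasure k S A) := h4.trans (by gcongr)
      _ = (r : ℝ≥0∞) ^ k * r * surfaceMeasure k S A := by ring
      _ ≤ c * surfaceMeasure k S A := by gcongr

end AreaFormula

/-! ### Integrals of functions extended by zero along an embedding -/

section ExtendByZero

theorem extend_zero_eq_indicator {α β : Type*} {e : α → β} (h : α → ℂ) :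
    Function.extend e h 0 = (range e).indicator (Function.extend e h 0) := by
  ext u
  by_cases hu : u ∈ range e
  · rw [indicator_of_mem hu]
  · rw [indicator_of_notMem hu, Function.extend_apply' _ _ _ (by simpa using hu)]
    rfl

variable {α β : Type*} [MeasurableSpace α] [MeasurableSpace β] {μ : Measure β} {e : α → β}

theorem integrable_extend_zero (he : MeasurableEmbedding e) {h : α → ℂ}
    (hh : Integrable h (μ.comap e)) : Integrable (Function.extend e h 0) μ := by
  rw [extend_zero_eq_indicator, integrable_indicator_iff he.measurableSet_range, IntegrableOn,
    ← he.map_comap, he.integrable_map_iff]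
  rwa [Function.extend_comp he.injective]

theorem integral_mul_extend_zero (he : MeasurableEmbedding e) (φ : β → ℂ) (h : α → ℂ) :
    ∫ u, φ u * Function.extend e h 0 u ∂μ = ∫ a, φ (e a) * h a ∂(μ.comap e) := by
  have h1 : (fun u => φ u * Function.extend e h 0 u) =
      (range e).indicator fun u => φ u * Function.extend e h 0 u := by
    ext u
    by_cases hu : u ∈ range e
    · rw [indicator_of_mem hu]
    · rw [indicator_of_notMem hu, Function.extend_apply' _ _ _ (by simpa using hu)]
      simp
  rw [h1, integral_indicator he.measurableSet_range, ← he.map_comap, he.integral_map]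
  simp only [he.injective.extend_apply]

theorem lintegral_enorm_extend_zero_sq (he : MeasurableEmbedding e) (h : α → ℂ) :
    ∫⁻ u, ‖Function.extend e h 0 u‖ₑ ^ 2 ∂μ = ∫⁻ a, ‖h a‖ₑ ^ 2 ∂(μ.comap e) := by
  have h1 : (fun u => ‖Function.extend e h 0 u‖ₑ ^ 2) =
      (range e).indicator fun u => ‖Function.extend e h 0 u‖ₑ ^ 2 := by
    ext u
    by_cases hu : u ∈ range e
    · rw [indicator_of_mem hu]
    · rw [indicator_of_notMem hu, Function.extend_apply' _ _ _ (by simpa using hu)]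
      simp
  rw [h1, lintegral_indicator he.measurableSet_range, ← he.map_comap, he.lintegral_map]
  simp only [he.injective.extend_apply]

end ExtendByZero

/-! ### The plane transform of the extension operator -/

section PlaneTransform

open scoped FourierTransform

variable {n k : ℕ} {S : Set (EuclideanSpace ℝ (Fin n))}
  {π : Submodule ℝ (EuclideanSpace ℝ (Fin n))}

/-- The density on `S`, with respect to the Lebesgue measure of the projection to `π`, whose
extension by zero to `π` has as its Fourier transform the restriction of `ĝdσ` to `π + y`. -/
noncomputable def projectedDensity (π : Submodule ℝ (EuclideanSpace ℝ (Fin n))) (g : S → ℂ)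
    (y : EuclideanSpace ℝ (Fin n)) (ξ : S) : ℂ :=
  inverseJacobian S π ξ • (g ξ * Complex.exp
    (-(2 * (Real.pi : ℂ) * Complex.I * ((inner ℝ y (ξ : EuclideanSpace ℝ (Fin n)) : ℝ) : ℂ))))

theorem enorm_projectedDensity {g : S → ℂ} {y : EuclideanSpace ℝ (Fin n)} {ξ : S}
    (hK : 0 ≤ inverseJacobian S π ξ) :
    ‖projectedDensity π g y ξ‖ₑ = ENNReal.ofReal (inverseJacobian S π ξ) * ‖g ξ‖ₑ := by
  have h1 : ‖Complex.exp (-(2 * (Real.pi : ℂ) * Complex.I *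
      ((inner ℝ y (ξ : EuclideanSpace ℝ (Fin n)) : ℝ) : ℂ)))‖ₑ = 1 := by
    rw [← ofReal_norm, Complex.norm_exp]
    simp
  rw [projectedDensity, enorm_smul, enorm_mul, h1, mul_one, Real.enorm_of_nonneg hK]

theorem IsC1Submanifold.integrable_projectedDensity (hS : IsC1Submanifold k S)
    (hπ : Module.finrank ℝ π = k) (hT : ∀ ξ ∈ S, tangentSpaceAt S ξ ⊓ πᗮ = ⊥)
    (hGT : ∀ ξ ∈ S, ∀ η ∈ S, Submodule.span ℝ {ξ - η} ⊓ πᗮ = ⊥) {g : S → ℂ}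
    (hg : Integrable g (surfaceMeasure k S))
    (y : EuclideanSpace ℝ (Fin n)) :
    Integrable (projectedDensity π g y) ((volume : Measure π).comap (projectTo S π)) := by
  have hK := hS.continuous_inverseJacobian hπ hT
  have h1 : Integrable (fun ξ : S => g ξ * Complex.exp
      (-(2 * (Real.pi : ℂ) * Complex.I * ((inner ℝ y (ξ : EuclideanSpace ℝ (Fin n)) : ℝ) : ℂ))))
      (surfaceMeasure k S) := by
    refine hg.mul_bdd (c := 1) ?_ (Eventually.of_forall fun ξ => ?_)
    · exact Continuous.aestronglyMeasurable (by fun_prop)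
    · rw [Complex.norm_exp]
      simp
  rw [hS.surfaceMeasure_eq_withDensity hπ hT hGT,
    integrable_withDensity_iff_integrable_smul' hK.measurable.ennreal_ofReal
      (Eventually.of_forall fun ξ => ENNReal.ofReal_lt_top)] at h1
  refine h1.congr (Eventually.of_forall fun ξ => ?_)
  simp only [projectedDensity]
  rw [ENNReal.toReal_ofReal (hS.inverseJacobian_pos hπ hT ξ).le]

/-- On the affine plane `π + y` the extension operator is a Fourier transform on `π`. -/
theorem IsC1Submanifold.extensionOperator_add_eq_fourier (hS : IsC1Submanifold k S)
    (hπ : Module.finrank ℝ π = k) (hT : ∀ ξ ∈ S, tangentSpaceAt S ξ ⊓ πᗮ = ⊥)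
    (hGT : ∀ ξ ∈ S, ∀ η ∈ S, Submodule.span ℝ {ξ - η} ⊓ πᗮ = ⊥) {g : S → ℂ}
    (y : EuclideanSpace ℝ (Fin n)) (x : π) :
    extensionOperator k S g ((x : EuclideanSpace ℝ (Fin n)) + y) =
      𝓕 (Function.extend (projectTo S π) (projectedDensity π g y) 0) x := by
  have hK := hS.continuous_inverseJacobian hπ hT
  have he := hS.measurableEmbedding_projectTo hGT
  rw [Real.fourier_eq', extensionOperator]
  simp only [smul_eq_mul]
  rw [integral_mul_extend_zero he (fun u : π =>
    Complex.exp (((-2 * Real.pi * inner ℝ u x : ℝ) : ℂ) * Complex.I)),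
    hS.surfaceMeasure_eq_withDensity hπ hT hGT,
    integral_withDensity_eq_integral_toReal_smul hK.measurable.ennreal_ofReal
      (Eventually.of_forall fun ξ => ENNReal.ofReal_lt_top)]
  refine integral_congr_ae (Eventually.of_forall fun ξ => ?_)
  simp only [projectedDensity]
  rw [ENNReal.toReal_ofReal (hS.inverseJacobian_pos hπ hT ξ).le, mul_smul_comm]
  congr 1
  rw [mul_left_comm, ← Complex.exp_add]
  congr 2
  have h1 : inner ℝ (projectTo S π ξ) x = inner ℝ (x : EuclideanSpace ℝ (Fin n)) ξ := by
    rw [projectTo, Submodule.inner_orthogonalProjectionOnto_eq_of_mem_right, real_inner_comm]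
  rw [h1, inner_add_left]
  push_cast
  ring

/-- By Plancherel the transform is the integral of `(K |g|)²` over the projection of `S`, with `K` the
Jacobian of the inverse projection; the area formula absorbs one factor `K`, and `K = 1 / |T^⊥ ∧ π|`. -/
theorem IsC1Submanifold.planeTransform_extensionOperator (hS : IsC1Submanifold k S)
    (hπ : Module.finrank ℝ π = k) (hT : ∀ ξ ∈ S, tangentSpaceAt S ξ ⊓ πᗮ = ⊥)
    (hGT : ∀ ξ ∈ S, ∀ η ∈ S, Submodule.span ℝ {ξ - η} ⊓ πᗮ = ⊥) {g : S → ℂ}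
    (hg : Integrable g (surfaceMeasure k S))
    (y : EuclideanSpace ℝ (Fin n)) :
    planeTransform (fun x => ‖extensionOperator k S g x‖ₑ ^ 2) π y =
      ∫⁻ ξ : S, ‖g ξ‖ₑ ^ 2 / ENNReal.ofReal (wedgeNorm (tangentSpaceAt S ξ)ᗮ π)
        ∂(surfaceMeasure k S) := by
  have hK := hS.continuous_inverseJacobian hπ hT
  have he := hS.measurableEmbedding_projectTo hGT
  have h1 := lintegral_enorm_fourier_sq
    (integrable_extend_zero he (hS.integrable_projectedDensity hπ hT hGT hg y))
  rw [lintegral_enorm_extend_zero_sq he] at h1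
  simp only [planeTransform, hS.extensionOperator_add_eq_fourier hπ hT hGT]
  rw [h1, hS.surfaceMeasure_eq_withDensity hπ hT hGT,
    lintegral_withDensity_eq_lintegral_mul_non_measurable _ hK.measurable.ennreal_ofReal
      (Eventually.of_forall fun ξ => ENNReal.ofReal_lt_top)]
  refine lintegral_congr fun ξ => ?_
  rw [enorm_projectedDensity (hS.inverseJacobian_pos hπ hT ξ).le, Pi.mul_apply, div_eq_mul_inv,
    hS.inv_ofReal_wedgeNorm hπ hT]
  ring

end PlaneTransform

/-! ### Lebesgue measure on affine planes -/

section AffinePlanes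

variable {n d : ℕ}

theorem volume_ball_one_eq_of_finrank_eq {V W : Type*} [NormedAddCommGroup V]
    [InnerProductSpace ℝ V] [FiniteDimensional ℝ V] [MeasurableSpace V] [BorelSpace V]
    [NormedAddCommGroup W] [InnerProductSpace ℝ W] [FiniteDimensional ℝ W] [MeasurableSpace W]
    [BorelSpace W] (h : Module.finrank ℝ V = Module.finrank ℝ W) :
    volume (Metric.ball (0 : V) 1) = volume (Metric.ball (0 : W) 1) := by
  let e : V ≃ₗᵢ[ℝ] W := (stdOrthonormalBasis ℝ V).equiv (stdOrthonormalBasis ℝ W) (finCongr h)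
  have h1 := e.measurePreserving.measure_preimage
    (Metric.isOpen_ball (x := (0 : W)) (ε := 1)).measurableSet.nullMeasurableSet
  rw [← h1]
  congr 1
  ext v
  simp

/-- Lebesgue measure on a plane, computed in the ambient space by thickening the plane with the unit
ball of its orthogonal complement. -/
theorem AffinePlane.lebesgue_apply_mul_volume_ball (p : AffinePlane d n)
    {A : Set (EuclideanSpace ℝ (Fin n))} (hA : MeasurableSet A) :
    p.lebesgue A * volume (Metric.ball (0 : EuclideanSpace ℝ (Fin (n - d))) 1) =
      volume {x : EuclideanSpace ℝ (Fin n) | p.direction.starProjection x + p.offset ∈ A ∧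
        ‖x - p.direction.starProjection x‖ < 1} := by
  -- The normalising constant depends only on `n - d`, not on the plane.
  have hfr : Module.finrank ℝ p.directionᗮ = n - d := by
    have h := p.direction.finrank_add_finrank_orthogonal
    rw [p.finrank_direction, finrank_euclideanSpace_fin] at h
    omega
  have hball : volume (Metric.ball (0 : EuclideanSpace ℝ (Fin (n - d))) 1) =
      volume (Metric.ball (0 : p.directionᗮ) 1) :=
    volume_ball_one_eq_of_finrank_eq (by rw [hfr, finrank_euclideanSpace_fin])
  have hm : Measurable fun w : p.direction => (w : EuclideanSpace ℝ (Fin n)) + p.offset := by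
    fun_prop
  have hmp := p.direction.measurePreserving_measurableEquivProd (0 : EuclideanSpace ℝ (Fin n))
  rw [InnerProductSpace.euclideanHausdorffMeasure_eq_volume] at hmp
  rw [AffinePlane.lebesgue, Measure.map_apply hm hA, hball, ← Measure.prod_prod,
    ← Measure.volume_eq_prod, ← hmp.measure_preimage
      ((hm hA).prod Metric.isOpen_ball.measurableSet).nullMeasurableSet]
  congr 1
  ext x
  have hx : ((p.directionᗮ.orthogonalProjectionOnto x : p.directionᗮ) : EuclideanSpace ℝ (Fin n)) =
      x - p.direction.starProjection x := by
    change p.directionᗮ.starProjection x = _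
    rw [Submodule.starProjection_orthogonal]
    rfl
  simp only [mem_preimage, Submodule.measurableEquivProd_apply, vsub_eq_sub, sub_zero, mem_prod,
    mem_ball_zero_iff, mem_ofPred_eq]
  rw [← hx]
  rfl

theorem AffinePlane.continuous_starProjection_offset :
    Continuous fun p : AffinePlane d n => ((p.direction.starProjection :
      EuclideanSpace ℝ (Fin n) →L[ℝ] EuclideanSpace ℝ (Fin n)), p.offset) :=
  continuous_induced_dom

/-- The thickened planes are the sections of one measurable set, so their volumes are measurable in
the plane. A map that is not almost everywhere measurable would make `Measure.bind` the
zero measure by convention. -/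
theorem AffinePlane.measurable_lebesgue :
    Measurable (AffinePlane.lebesgue : AffinePlane d n → Measure (EuclideanSpace ℝ (Fin n))) := by
  refine Measure.measurable_of_measurable_coe _ fun A hA => ?_
  set c := volume (Metric.ball (0 : EuclideanSpace ℝ (Fin (n - d))) 1)
  have hc0 : c ≠ 0 := (Metric.measure_ball_pos _ _ one_pos).ne'
  have hctop : c ≠ ∞ := measure_ball_lt_top.ne
  have hproj : Measurable fun q : AffinePlane d n × EuclideanSpace ℝ (Fin n) =>
      q.1.direction.starProjection q.2 := by
    have h1 : Measurable fun p : AffinePlane d n => (p.direction.starProjection :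
        EuclideanSpace ℝ (Fin n) →L[ℝ] EuclideanSpace ℝ (Fin n)) :=
      (continuous_fst.comp AffinePlane.continuous_starProjection_offset).measurable
    have h2 : Continuous fun q : (EuclideanSpace ℝ (Fin n) →L[ℝ] EuclideanSpace ℝ (Fin n)) ×
        EuclideanSpace ℝ (Fin n) => q.1 q.2 := isBoundedBilinearMap_apply.continuous
    exact h2.measurable.comp ((h1.comp measurable_fst).prodMk measurable_snd)
  have hoff : Measurable fun q : AffinePlane d n × EuclideanSpace ℝ (Fin n) => q.1.offset :=
    (continuous_snd.comp AffinePlane.continuous_starProjection_offset).measurable.comp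
      measurable_fst
  have hset : MeasurableSet {q : AffinePlane d n × EuclideanSpace ℝ (Fin n) |
      q.1.direction.starProjection q.2 + q.1.offset ∈ A ∧
        ‖q.2 - q.1.direction.starProjection q.2‖ < 1} :=
    ((hproj.add hoff) hA).inter
      (measurableSet_lt (measurable_snd.sub hproj).norm measurable_const)
  have hmeas := (measurable_measure_prodMk_left
    (ν := (volume : Measure (EuclideanSpace ℝ (Fin n)))) hset).div_const c
  convert hmeas using 2 with p
  rw [ENNReal.eq_div_iff hc0 hctop, mul_comm, p.lebesgue_apply_mul_volume_ball hA]
  rfl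

/-- The image of Lebesgue measure on `θ + z` under the projection to `π^⊥` is a multiple of Lebesgue
measure that does not depend on `z`. -/
theorem AffinePlane.lebesgue_preimage_orthogonalProjectionOnto (p : AffinePlane d n)
    (π : Submodule ℝ (EuclideanSpace ℝ (Fin n)))
    (hd : Module.finrank ℝ p.direction = Module.finrank ℝ πᗮ)
    (h0 : (πᗮ.orthogonalProjectionOnto.toLinearMap ∘ₗ p.direction.subtype).normDet ≠ 0)
    {A : Set πᗮ} (hA : MeasurableSet A) :
    ENNReal.ofReal (πᗮ.orthogonalProjectionOnto.toLinearMap ∘ₗ p.direction.subtype).normDet *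
      p.lebesgue ((fun x => πᗮ.orthogonalProjectionOnto x) ⁻¹' A) = volume A := by
  set B := πᗮ.orthogonalProjectionOnto.toLinearMap ∘ₗ p.direction.subtype with hB
  have hinj : Function.Injective B := ((B.normDet_ne_zero_tfae).out 0 4).1 h0
  have hsurj : Function.Surjective B :=
    (LinearMap.injective_iff_surjective_of_finrank_eq_finrank hd).1 hinj
  have hAm : MeasurableSet ((fun x => πᗮ.orthogonalProjectionOnto x) ⁻¹' A) :=
    πᗮ.orthogonalProjectionOnto.continuous.measurable hA
  rw [AffinePlane.lebesgue, Measure.map_apply (by fun_prop) hAm,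
    ← LinearMap.euclideanHausdorffMeasure_image_eq_normDet_mul_volume, hd,
    InnerProductSpace.euclideanHausdorffMeasure_eq_volume]
  have hpre : (fun w : p.direction => (w : EuclideanSpace ℝ (Fin n)) + p.offset) ⁻¹'
      ((fun x => πᗮ.orthogonalProjectionOnto x) ⁻¹' A) =
      B ⁻¹' ((fun u => u + πᗮ.orthogonalProjectionOnto p.offset) ⁻¹' A) := by
    ext w
    simp [hB]
  rw [hpre, image_preimage_eq _ hsurj, measure_preimage_add_right]

end AffinePlanes

/-! ### The Gauss map and the adjoint plane transform -/

section GaussMap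

variable {n k : ℕ} {S : Set (EuclideanSpace ℝ (Fin n))}
  {π : Submodule ℝ (EuclideanSpace ℝ (Fin n))}

/-- The orthogonal projection onto the range `T` of an injective map `R` is `R (R† R)⁻¹ R†`. -/
theorem exists_equiv_and_starProjection_eq {T : Submodule ℝ (EuclideanSpace ℝ (Fin n))}
    (h : T ⊓ πᗮ = ⊥) (hd : Module.finrank ℝ T = Module.finrank ℝ π) :
    ∃ e : π ≃L[ℝ] π, (e : π →L[ℝ] π) = (graphMap T π).adjoint ∘L graphMap T π ∧
      T.starProjection = graphMap T π ∘L
        ((graphMap T π).adjoint ∘L graphMap T π).inverse ∘L (graphMap T π).adjoint := by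
  set R := graphMap T π
  have hRinj : Function.Injective R := Function.LeftInverse.injective
    (g := π.orthogonalProjectionOnto) (orthogonalProjectionOnto_graphMap h hd)
  have hinj : Function.Injective (R.adjoint ∘L R).toLinearMap := by
    rw [← LinearMap.ker_eq_bot, ContinuousLinearMap.ker_adjoint_comp_self, LinearMap.ker_eq_bot]
    exact hRinj
  set e : π ≃L[ℝ] π := (LinearEquiv.ofInjectiveEndo _ hinj).toContinuousLinearEquiv
  have hee : (e : π →L[ℝ] π) = R.adjoint ∘L R := by
    ext x
    rfl
  refine ⟨e, hee, ?_⟩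
  rw [← hee, ContinuousLinearMap.inverse_equiv]
  ext1 x
  refine (Submodule.eq_starProjection_of_mem_of_inner_eq_zero (graphMap_mem _) fun t ht => ?_)
  have ht' : R (π.orthogonalProjectionOnto t) = t := graphMap_orthogonalProjectionOnto h hd ht
  rw [← ht', ← ContinuousLinearMap.adjoint_inner_left]
  have : R.adjoint (x - R (e.symm (R.adjoint x))) = 0 := by
    have h1 : R.adjoint (R (e.symm (R.adjoint x))) = e (e.symm (R.adjoint x)) :=
      (congrArg (fun L : π →L[ℝ] π => L (e.symm (R.adjoint x))) hee).symm
    rw [map_sub, h1, e.apply_symm_apply, sub_self]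
  change inner ℝ (R.adjoint (x - R (e.symm (R.adjoint x)))) _ = 0
  rw [this, inner_zero_left]

theorem IsC1Submanifold.continuous_starProjection_tangentSpaceAt (hS : IsC1Submanifold k S)
    (hπ : Module.finrank ℝ π = k) (hT : ∀ ξ ∈ S, tangentSpaceAt S ξ ⊓ πᗮ = ⊥) :
    Continuous fun ξ : S => (tangentSpaceAt S (ξ : EuclideanSpace ℝ (Fin n))).starProjection := by
  have hR := hS.continuous_graphMap hπ hT
  have hadj : Continuous fun ξ : S => (graphMap (tangentSpaceAt S ξ) π).adjoint :=
    (ContinuousLinearMap.adjoint (𝕜 := ℝ) (E := π)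
      (F := EuclideanSpace ℝ (Fin n))).continuous.comp hR
  have hd : ∀ ξ : S, Module.finrank ℝ (tangentSpaceAt S (ξ : EuclideanSpace ℝ (Fin n))) =
      Module.finrank ℝ π := fun ξ => by rw [hS.finrank_tangentSpaceAt ξ.2, hπ]
  have heq : (fun ξ : S => (tangentSpaceAt S (ξ : EuclideanSpace ℝ (Fin n))).starProjection) =
      fun ξ : S => graphMap (tangentSpaceAt S ξ) π ∘L
        ((graphMap (tangentSpaceAt S ξ) π).adjoint ∘L graphMap (tangentSpaceAt S ξ) π).inverse ∘L
          (graphMap (tangentSpaceAt S ξ) π).adjoint := by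
    ext1 ξ
    exact (exists_equiv_and_starProjection_eq (hT ξ ξ.2) (hd ξ)).choose_spec.2
  rw [heq]
  refine hR.clm_comp (Continuous.clm_comp ?_ hadj)
  refine continuous_iff_continuousAt.2 fun ξ => ?_
  obtain ⟨e, he, -⟩ := exists_equiv_and_starProjection_eq (hT ξ ξ.2) (hd ξ)
  have h1 : ContinuousAt ContinuousLinearMap.inverse
      ((graphMap (tangentSpaceAt S ξ) π).adjoint ∘L graphMap (tangentSpaceAt S ξ) π) := by
    rw [← he]
    exact (contDiffAt_map_inverse (n := 0) e).continuousAt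
  exact h1.comp (f := fun ξ : S => (graphMap (tangentSpaceAt S ξ) π).adjoint ∘L
    graphMap (tangentSpaceAt S ξ) π) (hadj.clm_comp hR).continuousAt

theorem tangentBundle.continuous_proj :
    Continuous (tangentBundle.proj : tangentBundle S → S) :=
  (continuous_fst.comp continuous_subtype_val).subtype_mk _

theorem IsC1Submanifold.measurable_gaussMap (hS : IsC1Submanifold k S)
    (hπ : Module.finrank ℝ π = k) (hT : ∀ ξ ∈ S, tangentSpaceAt S ξ ⊓ πᗮ = ⊥) :
    Measurable (gaussMap hS) := by
  refine Continuous.measurable (continuous_induced_rng.2 ?_)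
  refine Continuous.prodMk ?_ ?_
  · have h : Continuous fun p : tangentBundle S =>
        (tangentSpaceAt S (tangentBundle.proj p : EuclideanSpace ℝ (Fin n))).starProjection :=
      (hS.continuous_starProjection_tangentSpaceAt hπ hT).comp tangentBundle.continuous_proj
    have h' : Continuous fun p : tangentBundle S =>
        ContinuousLinearMap.id ℝ (EuclideanSpace ℝ (Fin n)) -
          (tangentSpaceAt S (tangentBundle.proj p : EuclideanSpace ℝ (Fin n))).starProjection :=
      continuous_const.sub h
    refine h'.congr fun p => ?_
    exact (Submodule.starProjection_orthogonal _).symm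
  · exact continuous_snd.comp continuous_subtype_val

/-- Each plane `T_ξ^⊥ + y` projects to `|T_ξ^⊥ ∧ π|⁻¹` times Lebesgue measure on `π^⊥`, whatever `y`
is, so that only the marginal of `ν` on `S` matters. -/
theorem IsC1Submanifold.planeTransformMeasure_adjointPlaneTransform (hS : IsC1Submanifold k S)
    (hπ : Module.finrank ℝ π = k) (hT : ∀ ξ ∈ S, tangentSpaceAt S ξ ⊓ πᗮ = ⊥)
    {ρ : S → ℝ≥0∞} (hρ : AEMeasurable ρ (surfaceMeasure k S)) {ν : Measure (tangentBundle S)}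
    (hν : ν.map tangentBundle.proj = (surfaceMeasure k S).withDensity ρ) :
    planeTransformMeasure (adjointPlaneTransform (ν.map (gaussMap hS))) π =
      (∫⁻ ξ : S, ρ ξ / ENNReal.ofReal (wedgeNorm (tangentSpaceAt S ξ)ᗮ π)
        ∂(surfaceMeasure k S)) • (volume : Measure πᗮ) := by
  have hgauss := hS.measurable_gaussMap hπ hT
  have hK := (hS.continuous_inverseJacobian hπ hT).measurable.ennreal_ofReal
  have hπc : Module.finrank ℝ πᗮ = n - k := by
    have h := π.finrank_add_finrank_orthogonal
    rw [hπ, finrank_euclideanSpace_fin] at h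
    omega
  ext A hA
  have hP : Measurable fun x : EuclideanSpace ℝ (Fin n) => πᗮ.orthogonalProjectionOnto x :=
    πᗮ.orthogonalProjectionOnto.continuous.measurable
  have hplane : ∀ p : tangentBundle S,
      (gaussMap hS p).lebesgue ((fun x => πᗮ.orthogonalProjectionOnto x) ⁻¹' A) =
        ENNReal.ofReal (inverseJacobian S π (tangentBundle.proj p)) * volume A := by
    intro p
    have hw := hS.inv_ofReal_wedgeNorm hπ hT (tangentBundle.proj p)
    have hKpos := hS.inverseJacobian_pos hπ hT (tangentBundle.proj p)
    have hw0 : ENNReal.ofReal (wedgeNorm (tangentSpaceAt S (tangentBundle.proj p))ᗮ π) ≠ 0 := by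
      rw [← ENNReal.inv_ne_top, hw]
      exact ENNReal.ofReal_ne_top
    have hdet := wedgeNorm_orthogonal_eq_normDet (tangentSpaceAt S (tangentBundle.proj p)) π
    have h := (gaussMap hS p).lebesgue_preimage_orthogonalProjectionOnto π
      (by rw [(gaussMap hS p).finrank_direction, hπc])
      (fun h0 => hw0 (by rw [hdet]; exact (congrArg ENNReal.ofReal h0).trans ENNReal.ofReal_zero))
      hA
    have h' : ENNReal.ofReal (wedgeNorm (tangentSpaceAt S (tangentBundle.proj p))ᗮ π) *
        (gaussMap hS p).lebesgue ((fun x => πᗮ.orthogonalProjectionOnto x) ⁻¹' A) = volume A := by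
      rw [hdet]
      exact h
    rw [← h', ← hw, ← mul_assoc, ENNReal.inv_mul_cancel hw0 ENNReal.ofReal_ne_top, one_mul]
  rw [planeTransformMeasure, Measure.map_apply hP hA, adjointPlaneTransform,
    Measure.bind_apply (hP hA) AffinePlane.measurable_lebesgue.aemeasurable,
    lintegral_map (f := fun p => p.lebesgue ((fun x => πᗮ.orthogonalProjectionOnto x) ⁻¹' A))
      ((Measure.measurable_coe (hP hA)).comp AffinePlane.measurable_lebesgue) hgauss]
  simp only [hplane]
  have hKproj : Measurable fun p : tangentBundle S =>
      ENNReal.ofReal (inverseJacobian S π (tangentBundle.proj p)) :=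
    hK.comp tangentBundle.continuous_proj.measurable
  rw [lintegral_mul_const _ hKproj,
    ← lintegral_map (f := fun ξ => ENNReal.ofReal (inverseJacobian S π ξ)) hK
      tangentBundle.continuous_proj.measurable,
    hν, lintegral_withDensity_eq_lintegral_mul₀ hρ hK.aemeasurable, Measure.smul_apply, smul_eq_mul]
  congr 1
  refine lintegral_congr fun ξ => ?_
  rw [Pi.mul_apply, div_eq_mul_inv, hS.inv_ofReal_wedgeNorm hπ hT]

end GaussMap

theorem hasPlaneTransformAt_of_planeTransformMeasure_eq_smul {n : ℕ}
    {m : Measure (EuclideanSpace ℝ (Fin n))} {π : Submodule ℝ (EuclideanSpace ℝ (Fin n))}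
    {c : ℝ≥0∞} (h : planeTransformMeasure m π = c • volume) (y : πᗮ) :
    HasPlaneTransformAt m π y c := by
  refine tendsto_const_nhds.congr' ?_
  filter_upwards [self_mem_nhdsWithin] with ε hε
  rw [h, Measure.smul_apply, smul_eq_mul, ENNReal.mul_div_cancel_right
    (Metric.measure_ball_pos _ _ hε).ne' measure_ball_lt_top.ne]

end KPlane

theorem mainTheorem1 {n k : ℕ} (S : Set (EuclideanSpace ℝ (Fin n)))
    (hS : KPlane.IsC1Submanifold k S)
    (π : Submodule ℝ (EuclideanSpace ℝ (Fin n))) (hπ : Module.finrank ℝ π = k)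
    (hT : ∀ ξ ∈ S, KPlane.tangentSpaceAt S ξ ⊓ πᗮ = ⊥)
    (hGT : ∀ ξ ∈ S, ∀ η ∈ S, Submodule.span ℝ {ξ - η} ⊓ πᗮ = ⊥)
    (g : S → ℂ) (hg : Integrable g (KPlane.surfaceMeasure k S)) :
    (∀ y ∈ πᗮ,
      KPlane.planeTransform (fun x => ‖KPlane.extensionOperator k S g x‖ₑ ^ 2) π y =
        ∫⁻ ξ : S, ‖g ξ‖ₑ ^ 2 /
          ENNReal.ofReal (KPlane.wedgeNorm (KPlane.tangentSpaceAt S ξ)ᗮ π)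
          ∂(KPlane.surfaceMeasure k S)) ∧
    ∀ (ν : Measure (KPlane.tangentBundle S)) (μ : Measure (KPlane.AffinePlane (n - k) n)),
      ν.map KPlane.tangentBundle.proj =
          (KPlane.surfaceMeasure k S).withDensity (fun ξ => ‖g ξ‖ₑ ^ 2) →
      μ = ν.map (KPlane.gaussMap hS) →
      (∀ y : πᗮ, KPlane.HasPlaneTransformAt (KPlane.adjointPlaneTransform μ) π y
        (∫⁻ ξ : S, ‖g ξ‖ₑ ^ 2 /
          ENNReal.ofReal (KPlane.wedgeNorm (KPlane.tangentSpaceAt S ξ)ᗮ π)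
          ∂(KPlane.surfaceMeasure k S))) ∧
      KPlane.planeTransformMeasure (KPlane.adjointPlaneTransform μ) π =
        (∫⁻ ξ : S, ‖g ξ‖ₑ ^ 2 /
          ENNReal.ofReal (KPlane.wedgeNorm (KPlane.tangentSpaceAt S ξ)ᗮ π)
          ∂(KPlane.surfaceMeasure k S)) • (volume : Measure πᗮ) := by
  refine ⟨fun y _ => hS.planeTransform_extensionOperator hπ hT hGT hg y, fun ν μ hν hμ => ?_⟩
  have h := hS.planeTransformMeasure_adjointPlaneTransform hπ hT
    (hg.aestronglyMeasurable.enorm.pow_const 2) hν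
  rw [← hμ] at h
  exact ⟨KPlane.hasPlaneTransformAt_of_planeTransformMeasure_eq_smul h, h⟩
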